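/- **Setting.** Let $\Sigma$ be a smooth oriented surface without boundary (not necessarily compact), $\Gamma$ a free abelian group, $\partial:\Gamma\to H_1(\Sigma,\mathbb Z)$ a homomorphism, $\langle\beta_1,\beta_2\rangle=\langle\partial\beta_1,\partial\beta_2\rangle$ the pullback of the intersection pairing, and $Q$ a quadratic form on $\Gamma_{\mathbb R}=\Gamma\otimes\mathbb R$. A *sector* $S\subset\mathbb R^2=\mathbb C$ is a strictly convex sector with vertex $0$, without $0$, with non-empty interior; parts of its boundary may or may not belong to it. $I_S$ is the interval of rays in $S$, ordered clockwise. For a homomorphism $Z:\Gamma\to\mathbb C$, $\Gamma(S,Z,Q)$ is the set of sums of elements of $\{\beta: Z(\beta)\in S,\ Q(\beta)\ge 0\}$, and the charges of vertices below are the non-zero ones. **Multi-disk homology.** Let $P\subset\Gamma$ be closed under addition. $MDH_0(\beta;S,P)$ is the $\mathbb Q$-vector space generated by the nice chains $W_{T_0,\{\gamma_v\}}$, where $T_0$ is a finite set of vertices $v$ with charges $\beta_v\in P$, $\sum_v\beta_v=\beta$, and the $\gamma_v$ are pairwise disjoint smooth $1$-cycles in $\Sigma\times I_S$ with $[\gamma_v]=\partial\beta_v$,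 considered as currents. The relations are: $W_1-W_0=0$ for an isotopy $\{\gamma_{v,t}\}_{0\le t\le 1}$ without crossings of different cycles, and $W_1-W_0=-\varepsilon\,W'$ for an isotopy in which exactly one crossing occurs, transversely and with sign $\varepsilon$, between $\gamma_{v_1,t}$ and $\gamma_{v_2,t}$ at time $t_0$, where $W'$ is given by the cycles at time $t_0$ with $v_1,v_2$ replaced by one vertex with charge $\beta_{v_1}+\beta_{v_2}$ and cycle $\gamma_{v_1,t_0}+\gamma_{v_2,t_0}$. ($\varepsilon$ is the sign of the determinant of the tangents of $\gamma_{v_1,t_0}$ and $\gamma_{v_2,t_0}$ and of the velocity of the first relative to the second, for the product of the orientation of $\Sigma$ and the clockwise orientation of $I_S$.) Write $MDH_0(\beta;S,Z,Q)$ for $P=\Gamma(S,Z,Q)\setminus\{0\}$. For tuples of trees, $MDH_0(\beta_1,\dots,\beta_r;S,Z,Q)$ is defined in the same way, with crossings considered only within each tree; $\cup$ is the union of chains, and $\mathcal F_{\beta_1,\dots,\beta_r}$ sums over the ways to split the vertices of $T_0$ into trees of charges $\beta_1,\dots,\beta_r$, splittings being counted up to permutations of trees of equal charge. Let $\mathfrak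 g_P=\bigoplus_{\beta\in P}\mathbb Q e_\beta$ with $[e_{\beta_1},e_{\beta_2}]=\langle\beta_1,\beta_2\rangle e_{\beta_1+\beta_2}$ and $\hat{\mathfrak g}_P=\bigoplus_{\beta\in P}\mathbb Q\hat e_\beta$ with $[\hat e_{\beta_1},\hat e_{\beta_2}]=(-1)^{\langle\beta_1,\beta_2\rangle}\langle\beta_1,\beta_2\rangle\hat e_{\beta_1+\beta_2}$. $U(\cdot)_\beta$ is the span in the enveloping algebra of the products of generators of total charge $\beta$. There is a natural map $MDH_0(\beta;S,P)\to U(\mathfrak g_P)_\beta$, characterized by being natural in $P$ and sending a chain whose cycles $\gamma_{v_0},\dots,\gamma_{v_r}$ lie over single rays $\theta_{v_0},\dots,\theta_{v_r}$ in strictly clockwise order to $e_{\beta_{v_0}}\cdots e_{\beta_{v_r}}$. **Stability structures.** Spin structures $\sigma$ on $\Sigma$ are identified with quadratic refinements $\sigma:H_1(\Sigma,\mathbb Z)\to\{\pm1\}$, $\sigma(a)\sigma(b)=(-1)^{\langle a,b\rangle}\sigma(a+b)$, on which $\epsilon\in H^1(\Sigma,\mathbb Z_2)=\mathrm{Hom}(H_1(\Sigma,\mathbb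 Z),\pm1)$ acts by multiplication. A *string stability structure* consists of $Q$, a homomorphism $Z:\Gamma\to\mathbb C$ with $Q$ negative definite on the kernel of $Z$ in $\Gamma_{\mathbb R}$, and classes $W^\sigma_{\beta,S}\in MDH_0(\beta;S,Z,Q)$ for all $S,\beta,\sigma$, such that * $W^{\epsilon\sigma}_{\beta,S}=\epsilon(\partial\beta)W^\sigma_{\beta,S}$; * $\mathcal F_{\beta_1,\dots,\beta_r}(W^\sigma_{\beta,S})=W^\sigma_{\beta_1,S}\cup\dots\cup W^\sigma_{\beta_r,S}/|\mathrm{Aut}\{\beta_1,\dots,\beta_r\}|$ whenever $\beta=\beta_1+\dots+\beta_r$, $r\ge1$; * $W^\sigma_{\beta,S}=\sum_{\beta_1+\beta_2=\beta}W^\sigma_{\beta_1,S_1}\cup W^\sigma_{\beta_2,S_2}$ (a finite sum; here the union of two chains over disjoint sectors is considered as a chain over $S$) whenever $S=S_1\sqcup S_2$ in clockwise order. $A^\sigma_S\in\prod_\beta U(\mathfrak g_{\Gamma(S,Z,Q)})_\beta$ has as $\beta$-component the image of $W^\sigma_{\beta,S}$, and $\hat A_S\in\prod_\beta U(\hat{\mathfrak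 g}_{\Gamma(S,Z,Q)})_\beta$ is the image of $A^\sigma_S$ under $e_\beta\mapsto\sigma(\partial\beta)\hat e_\beta$. $Z$ is on an *$(S,\beta)$-wall of second type* if $\beta=\beta_1+\beta_2$ with $\beta_1,\beta_2\in\Gamma(\overline S\setminus\{0\},Z,Q)\cup\{0\}$, $\beta_1\ne0$ and $Z(\beta_1)\in\partial S$. A *variation of string stability structures* is a family of string stability structures $(Z_t,\{W^\sigma_{\beta,S,t}\})_{0\le t\le1}$ with fixed $Q$ such that, for all $S,\beta$: if $Z_t$ is not on an $(S,\beta)$-wall of second type for any $t\in[0,1]$, then $W^\sigma_{\beta,S,t}$ does not depend on $t$ (the classes being compared in $MDH_0(\beta;S,\Gamma)$). **Proposition.** Let $(Z_t,\{W^\sigma_{\beta,S,t}\})_{0\le t\le 1}$ be a variation of string stability structures, $S$ a sector and $\beta\in\Gamma$, and assume that $Z_t$ is not on an $(S,\beta)$-wall of second type for any $t\in[0,1]$. Then the $\beta$-component of $\hat A_S$, considered as an element of $U(\hat{\mathfrak g}_\Gamma)$, depends neither on $t\in[0,1]$ nor on the spin structure $\sigma$. -/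

import Mathlib

open scoped Manifold ContDiff TensorProduct

noncomputable section

namespace MultiDisk

open scoped Classical
open CategoryTheory AlgebraicTopology

attribute [local instance 100] LieRing.ofAssociativeRing

/-! ### Oriented surfaces, first homology, intersection pairing -/

/-- The model plane of a surface. -/
abbrev Plane := EuclideanSpace ℝ (Fin 2)

/-- A smooth oriented surface without boundary, not necessarily compact or connected: the
orientation is the one of the atlas, all of whose transition maps have positive Jacobian. -/
class OrientedSurface (X : Type) [TopologicalSpace X] [ChartedSpace Plane X] : Prop extends
    T2Space X, SecondCountableTopology X, IsManifold (𝓡 2) ∞ X where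
  oriented : ∀ e ∈ atlas Plane X, ∀ e' ∈ atlas Plane X, ∀ p ∈ (e.symm ≫ₕ e').source,
    0 < (fderiv ℝ (e.symm ≫ₕ e') p).det

/-- The integral singular chain complex of a space. -/
abbrev singularChains (X : Type) [TopologicalSpace X] : ChainComplex (ModuleCat.{0} ℤ) ℕ :=
  ((singularChainComplexFunctor (ModuleCat.{0} ℤ)).obj (ModuleCat.of ℤ ℤ)).obj (TopCat.of X)

/-- The first singular homology group `H₁(X, ℤ)`. -/
abbrev H1 (X : Type) [TopologicalSpace X] : Type :=
  ((singularHomologyFunctor (ModuleCat.{0} ℤ) 1).obj (ModuleCat.of ℤ ℤ)).obj (TopCat.of X)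

/-- The singular `1`-simplex given by the restriction of a path to `[0, 1]`, where the point
of the standard simplex with barycentric coordinates `(1 - s, s)` is sent to `c s`. -/
def pathSimplex {X : Type} [TopologicalSpace X] (c : C(ℝ, X)) :
    (TopCat.toSSet.obj (TopCat.of X)).obj (.op (SimplexCategory.mk 1)) :=
  (TopCat.toSSetObjEquiv (TopCat.of X) (.op (SimplexCategory.mk 1))).symm
    (c.comp ⟨fun p : stdSimplex ℝ (Fin 2) => p.1 1,
      (continuous_apply (1 : Fin 2)).comp continuous_subtype_val⟩)

/-- The singular `1`-chain `1 • c` of a path `c`. -/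
def pathChain {X : Type} [TopologicalSpace X] (c : C(ℝ, X)) : (singularChains X).X 1 :=
  (Limits.Sigma.ι (fun _ : (TopCat.toSSet.obj (TopCat.of X)).obj (.op (SimplexCategory.mk 1)) =>
    ModuleCat.of ℤ ℤ) (pathSimplex c)).hom (1 : ℤ)

/-- The singular `1`-chain `z` is a cycle whose homology class is `h`. -/
def Represents {X : Type} [TopologicalSpace X] (z : (singularChains X).X 1) (h : H1 X) : Prop :=
  ∃ c : (singularChains X).cycles 1,
    ((singularChains X).iCycles 1).hom c = z ∧ ((singularChains X).homologyπ 1).hom c = h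

section Surface

variable {X : Type} [TopologicalSpace X] [ChartedSpace Plane X]

/-- The velocity of a curve on the surface, in the coordinates of the preferred chart at the
current point of the curve. -/
def velocity (c : ℝ → X) (s : ℝ) : Plane := mfderiv 𝓘(ℝ, ℝ) (𝓡 2) c s (1 : ℝ)

/-- `det (a, b)`; its sign tells whether `(a, b)` is a positive frame. -/
def planeDet (a b : Plane) : ℝ := a 0 * b 1 - a 1 * b 0

/-- A smooth closed curve on the surface, parametrized with period `1`. -/
def IsClosedCurve (c : C(ℝ, X)) : Prop :=
  ContMDiff 𝓘(ℝ, ℝ) (𝓡 2) ∞ c ∧ ∀ s, c (s + 1) = c s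

/-- `ip` is the intersection pairing of the oriented surface: on the classes of two closed curves
that meet transversely it is the number of intersections counted with sign. As `H₁` is generated
by closed curves, and any two of them can be made transverse, this determines `ip`. -/
def IsIntersectionPairing (ip : H1 X →+ H1 X →+ ℤ) : Prop :=
  (∀ a b, ip a b = -ip b a) ∧
  ∀ c d : C(ℝ, X), IsClosedCurve c → IsClosedCurve d →
    (∀ s s', c s = d s' → planeDet (velocity c s) (velocity d s') ≠ 0) →
    ∀ h k : H1 X, Represents (pathChain c) h → Represents (pathChain d) k →
      ip h k = ∑ᶠ p ∈ {p : ℝ × ℝ | p.1 ∈ Set.Ico 0 1 ∧ p.2 ∈ Set.Ico 0 1 ∧ c p.1 = d p.2},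
        ((SignType.sign (planeDet (velocity c p.1) (velocity d p.2)) : SignType) : ℤ)

variable (X) in
/-- The intersection pairing on `H₁(X, ℤ)`. -/
def intersection : H1 X →+ H1 X →+ ℤ :=
  if h : ∃ ip : H1 X →+ H1 X →+ ℤ, IsIntersectionPairing ip then h.choose else 0

theorem intersection_skew (a b : H1 X) : intersection X a b = -intersection X b a := by
  unfold intersection
  split_ifs with h
  · exact h.choose_spec.1 a b
  · simp

variable (X) in
/-- A spin structure, in the form of a quadratic refinement of `(-1) ^ ⟨·, ·⟩` on `H₁(X, ℤ)`. -/
structure SpinStructure where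
  toFun : H1 X → ℤˣ
  map_mul' : ∀ a b, toFun a * toFun b = (intersection X a b).negOnePow * toFun (a + b)

/-- The action of `H¹(X, ℤ/2) = Hom(H₁(X, ℤ), ±1)` on spin structures. -/
def SpinStructure.twist (ε : Multiplicative (H1 X) →* ℤˣ) (σ : SpinStructure X) :
    SpinStructure X where
  toFun a := ε (Multiplicative.ofAdd a) * σ.toFun a
  map_mul' a b := by
    have h := σ.map_mul' a b
    rw [ofAdd_add, map_mul, mul_mul_mul_comm, h]
    exact mul_left_comm _ _ _

end Surface

/-! ### The Lie algebras of charges -/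

/-- Structure constants `coeff` of a Lie bracket `[e_a, e_b] = coeff a b • e_{a + b}`. -/
structure BracketCoeff (Γ : Type) [AddCommGroup Γ] where
  coeff : Γ → Γ → ℚ
  skew : ∀ a b, coeff a b = -coeff b a
  jacobi : ∀ a b c, coeff b c * coeff a (b + c) =
    coeff a b * coeff (a + b) c + coeff a c * coeff b (a + c)

/-- The vector space `⨁_β ℚ e_β`, with `e_β = Finsupp.single β 1`. -/
def ChargeLie {Γ : Type} [AddCommGroup Γ] (_κ : BracketCoeff Γ) : Type := Γ →₀ ℚ

section Lie

variable {Γ : Type} [AddCommGroup Γ] (κ : BracketCoeff Γ)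

instance : AddCommGroup (ChargeLie κ) := inferInstanceAs (AddCommGroup (Γ →₀ ℚ))
instance : Module ℚ (ChargeLie κ) := inferInstanceAs (Module ℚ (Γ →₀ ℚ))

/-- The generator `e_β`. -/
def gen (β : Γ) : ChargeLie κ := (Finsupp.single β 1 : Γ →₀ ℚ)

/-- Linear maps out of `⨁_β ℚ e_β`. -/
def lieLift {M : Type} [AddCommGroup M] [Module ℚ M] (f : Γ → M) : ChargeLie κ →ₗ[ℚ] M :=
  (Finsupp.linearCombination ℚ f : (Γ →₀ ℚ) →ₗ[ℚ] M)

theorem lieLift_gen {M : Type} [AddCommGroup M] [Module ℚ M] (f : Γ → M) (β : Γ) :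
    lieLift κ f (gen κ β) = f β := by
  have := Finsupp.linearCombination_single ℚ (v := f) 1 β
  rw [one_smul] at this
  exact this

theorem lie_hom_ext {M : Type} [AddCommGroup M] [Module ℚ M] {f g : ChargeLie κ →ₗ[ℚ] M}
    (h : ∀ β, f (gen κ β) = g (gen κ β)) : f = g :=
  Finsupp.lhom_ext' (M := ℚ) (R := ℚ) (φ := f) (ψ := g) fun β => LinearMap.ext_ring (h β)

/-- The bracket, as a bilinear map. -/
def bracketMap : ChargeLie κ →ₗ[ℚ] ChargeLie κ →ₗ[ℚ] ChargeLie κ :=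
  lieLift κ fun a => lieLift κ fun b => κ.coeff a b • gen κ (a + b)

theorem bracketMap_gen (a b : Γ) :
    bracketMap κ (gen κ a) (gen κ b) = κ.coeff a b • gen κ (a + b) := by
  simp [bracketMap, lieLift_gen]

theorem bracketMap_skew (x y : ChargeLie κ) : bracketMap κ x y = -bracketMap κ y x := by
  have : bracketMap κ = -(bracketMap κ).flip := by
    refine lie_hom_ext κ fun a => lie_hom_ext κ fun b => ?_
    simp [bracketMap_gen, κ.skew a b, add_comm a b]
  have h := congrArg (fun f => f x y) this
  simpa using h

theorem bracketMap_leibniz (x y z : ChargeLie κ) : bracketMap κ x (bracketMap κ y z) =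
    bracketMap κ (bracketMap κ x y) z + bracketMap κ y (bracketMap κ x z) := by
  have key : ∀ a b c, bracketMap κ (gen κ a) (bracketMap κ (gen κ b) (gen κ c)) =
      bracketMap κ (bracketMap κ (gen κ a) (gen κ b)) (gen κ c) +
        bracketMap κ (gen κ b) (bracketMap κ (gen κ a) (gen κ c)) := by
    intro a b c
    simp only [bracketMap_gen, map_smul, LinearMap.smul_apply, smul_smul]
    rw [κ.jacobi, add_smul, add_assoc, show b + (a + c) = a + (b + c) by abel]
  have hx : ∀ b c, bracketMap κ x (bracketMap κ (gen κ b) (gen κ c)) =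
      bracketMap κ (bracketMap κ x (gen κ b)) (gen κ c) +
        bracketMap κ (gen κ b) (bracketMap κ x (gen κ c)) := by
    intro b c
    have : (bracketMap κ).flip (bracketMap κ (gen κ b) (gen κ c)) =
        (bracketMap κ).flip (gen κ c) ∘ₗ (bracketMap κ).flip (gen κ b) +
          bracketMap κ (gen κ b) ∘ₗ (bracketMap κ).flip (gen κ c) :=
      lie_hom_ext κ fun a => by simpa using key a b c
    simpa using congrArg (fun f => f x) this
  have hy : ∀ c, bracketMap κ x (bracketMap κ y (gen κ c)) =
      bracketMap κ (bracketMap κ x y) (gen κ c) +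
        bracketMap κ y (bracketMap κ x (gen κ c)) := by
    intro c
    have : bracketMap κ x ∘ₗ (bracketMap κ).flip (gen κ c) =
        (bracketMap κ).flip (gen κ c) ∘ₗ bracketMap κ x +
          (bracketMap κ).flip (bracketMap κ x (gen κ c)) :=
      lie_hom_ext κ fun b => by simpa using hx b c
    simpa using congrArg (fun f => f y) this
  have : bracketMap κ x ∘ₗ bracketMap κ y =
      bracketMap κ (bracketMap κ x y) + bracketMap κ y ∘ₗ bracketMap κ x :=
    lie_hom_ext κ fun c => by simpa using hy c
  simpa using congrArg (fun f => f z) this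

/-- The Lie algebra with `[e_a, e_b] = coeff a b • e_{a + b}`. -/
instance : LieRing (ChargeLie κ) where
  toAddCommGroup := inferInstance
  bracket x y := bracketMap κ x y
  add_lie x y z := congrArg (fun f => f z) (map_add (bracketMap κ) x y)
  lie_add x y z := map_add (bracketMap κ x) y z
  lie_self x := by
    have h := bracketMap_skew κ x x
    have h2 : (2 : ℚ) • bracketMap κ x x = 0 := by
      rw [two_smul]; nth_rewrite 1 [h]; exact neg_add_cancel _
    exact (smul_eq_zero.mp h2).resolve_left (by norm_num)
  leibniz_lie x y z := bracketMap_leibniz κ x y z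

instance : LieAlgebra ℚ (ChargeLie κ) where
  toModule := inferInstanceAs (Module ℚ (Γ →₀ ℚ))
  lie_smul r x y := map_smul (bracketMap κ x) r y

theorem lie_gen (a b : Γ) : ⁅gen κ a, gen κ b⁆ = κ.coeff a b • gen κ (a + b) :=
  bracketMap_gen κ a b

/-- The Lie subalgebra `⨁_{β ∈ P} ℚ e_β`. -/
def chargeSubalgebra (P : AddSubsemigroup Γ) : LieSubalgebra ℚ (ChargeLie κ) where
  __ := Submodule.span ℚ (gen κ '' (P : Set Γ))
  lie_mem' := by
    intro x y hx hy
    change bracketMap κ x y ∈ Submodule.span ℚ (gen κ '' (P : Set Γ))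
    have : Submodule.map₂ (bracketMap κ) (Submodule.span ℚ (gen κ '' (P : Set Γ)))
        (Submodule.span ℚ (gen κ '' (P : Set Γ))) ≤ Submodule.span ℚ (gen κ '' (P : Set Γ)) := by
      rw [Submodule.map₂_span_span, Submodule.span_le]
      rintro _ ⟨_, ⟨a, ha, rfl⟩, _, ⟨b, hb, rfl⟩, rfl⟩
      change bracketMap κ (gen κ a) (gen κ b) ∈ _
      rw [bracketMap_gen]
      exact Submodule.smul_mem _ _ (Submodule.subset_span ⟨a + b, P.add_mem ha hb, rfl⟩)
    exact this (Submodule.apply_mem_map₂ _ hx hy)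

theorem chargeSubalgebra_mono {P P' : AddSubsemigroup Γ} (h : P ≤ P') :
    chargeSubalgebra κ P ≤ chargeSubalgebra κ P' :=
  Submodule.span_mono (Set.image_mono h)

/-- The enveloping algebra of `⨁_{β ∈ P} ℚ e_β`. -/
abbrev Envelope (P : AddSubsemigroup Γ) : Type :=
  UniversalEnvelopingAlgebra ℚ (chargeSubalgebra κ P)

/-- The generator `e_β`, `β ∈ P`, in the enveloping algebra. -/
def envGen (P : AddSubsemigroup Γ) (β : P) : Envelope κ P :=
  UniversalEnvelopingAlgebra.ι ℚ
    ⟨gen κ β, Submodule.subset_span ⟨β, β.2, rfl⟩⟩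

/-- The subspace of the enveloping algebra spanned by the products `e_{β₁} ⋯ e_{βᵣ}` with
`β₁ + ⋯ + βᵣ = β`. -/
def gradedPiece (P : AddSubsemigroup Γ) (β : Γ) : Submodule ℚ (Envelope κ P) :=
  Submodule.span ℚ {x | ∃ l : List P, (l.map Subtype.val).sum = β ∧ x = (l.map (envGen κ P)).prod}

/-- The map of enveloping algebras induced by an inclusion of sets of charges. -/
def envIncl {P P' : AddSubsemigroup Γ} (h : P ≤ P') : Envelope κ P →ₐ[ℚ] Envelope κ P' :=
  UniversalEnvelopingAlgebra.lift ℚ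
    ((UniversalEnvelopingAlgebra.ι ℚ).comp
      (LieSubalgebra.inclusion (chargeSubalgebra_mono κ h)))

end Lie

section Charges

variable {X : Type} [TopologicalSpace X] [ChartedSpace Plane X]
variable {Γ : Type} [AddCommGroup Γ] (bd : Γ →+ H1 X)

/-- The skew pairing `⟨β₁, β₂⟩ = ⟨∂β₁, ∂β₂⟩` on charges. -/
def pairing (a b : Γ) : ℤ := intersection X (bd a) (bd b)

/-- `[e_a, e_b] = ⟨a, b⟩ e_{a + b}`. -/
def plainCoeff : BracketCoeff Γ where
  coeff a b := pairing bd a b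
  skew a b := by
    have := intersection_skew (bd a) (bd b)
    simp only [pairing]; rw [this]; push_cast; ring
  jacobi a b c := by
    have h := intersection_skew (bd b) (bd a)
    simp only [pairing, map_add, AddMonoidHom.add_apply]; rw [h]; push_cast; ring

/-- `[ê_a, ê_b] = (-1) ^ ⟨a, b⟩ ⟨a, b⟩ ê_{a + b}`. -/
def twistedCoeff : BracketCoeff Γ where
  coeff a b := (((pairing bd a b).negOnePow : ℤˣ) : ℤ) * pairing bd a b
  skew a b := by
    have := intersection_skew (bd a) (bd b)
    simp only [pairing]; rw [this, Int.negOnePow_neg]; push_cast; ring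
  jacobi a b c := by
    have h := intersection_skew (bd b) (bd a)
    simp only [pairing, map_add, AddMonoidHom.add_apply]
    rw [h]
    simp only [Int.negOnePow_add, Int.negOnePow_neg]
    push_cast
    ring

/-- The Lie algebra map `e_β ↦ σ(∂β) ê_β` on all charges. -/
def sigmaLie (σ : SpinStructure X) :
    ChargeLie (plainCoeff bd) →ₗ⁅ℚ⁆ ChargeLie (twistedCoeff bd) where
  __ := lieLift (plainCoeff bd) fun β => (((σ.toFun (bd β) : ℤˣ) : ℤ) : ℚ) • gen (twistedCoeff bd) β
  map_lie' := by
    intro x y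
    change lieLift (plainCoeff bd) _ (bracketMap _ x y) =
      bracketMap (twistedCoeff bd) (lieLift (plainCoeff bd) _ x) (lieLift (plainCoeff bd) _ y)
    set f := lieLift (plainCoeff bd)
      fun β => (((σ.toFun (bd β) : ℤˣ) : ℤ) : ℚ) • gen (twistedCoeff bd) β with hf
    have : (bracketMap (plainCoeff bd)).compr₂ f = (bracketMap (twistedCoeff bd)).compl₁₂ f f := by
      refine lie_hom_ext _ fun a => lie_hom_ext _ fun b => ?_
      have h := σ.map_mul' (bd a) (bd b)
      have h2 : (((σ.toFun (bd a) : ℤˣ) : ℤ) : ℚ) * (((σ.toFun (bd b) : ℤˣ) : ℤ) : ℚ) =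
          (((intersection X (bd a) (bd b)).negOnePow : ℤˣ) : ℤ) *
            (((σ.toFun (bd a + bd b) : ℤˣ) : ℤ) : ℚ) := by
        have := congrArg (fun u : ℤˣ => ((u : ℤ) : ℚ)) h
        simpa using this
      have h3 : ((((intersection X (bd a) (bd b)).negOnePow : ℤˣ) : ℤ) : ℚ) *
          (((intersection X (bd a) (bd b)).negOnePow : ℤˣ) : ℤ) = 1 := by
        rw [← Int.cast_mul, ← Units.val_mul, Int.units_mul_self]; simp
      simp only [LinearMap.compr₂_apply, LinearMap.compl₁₂_apply, bracketMap_gen, map_smul, hf,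
        lieLift_gen, LinearMap.smul_apply, smul_smul]
      congr 1
      simp only [plainCoeff, twistedCoeff, pairing, map_add]
      generalize ((((intersection X (bd a) (bd b)).negOnePow : ℤˣ) : ℤ) : ℚ) = u at *
      generalize (((σ.toFun (bd a + bd b) : ℤˣ) : ℤ) : ℚ) = v at *
      generalize (((σ.toFun (bd a) : ℤˣ) : ℤ) : ℚ) = p at *
      generalize (((σ.toFun (bd b) : ℤˣ) : ℤ) : ℚ) = q at *
      generalize ((intersection X (bd a) (bd b) : ℤ) : ℚ) = n at *
      linear_combination (-(u * n)) * h2 - (v * n) * h3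
    simpa using congrArg (fun f => f x y) this

theorem sigmaLie_mem (σ : SpinStructure X) (P : AddSubsemigroup Γ)
    (x : ChargeLie (plainCoeff bd)) (hx : x ∈ chargeSubalgebra (plainCoeff bd) P) :
    sigmaLie bd σ x ∈ chargeSubalgebra (twistedCoeff bd) P := by
  change x ∈ Submodule.span ℚ _ at hx
  change sigmaLie bd σ x ∈ Submodule.span ℚ _
  induction hx using Submodule.span_induction with
  | mem x h =>
    obtain ⟨β, hβ, rfl⟩ := h
    have : sigmaLie bd σ (gen (plainCoeff bd) β) =
      (((σ.toFun (bd β) : ℤˣ) : ℤ) : ℚ) • gen (twistedCoeff bd) β := lieLift_gen _ _ β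
    rw [this]
    exact Submodule.smul_mem _ _ (Submodule.subset_span ⟨β, hβ, rfl⟩)
  | zero => rw [map_zero]; exact Submodule.zero_mem _
  | add x y _ _ hx hy => rw [map_add]; exact Submodule.add_mem _ hx hy
  | smul r x _ hx => rw [map_smul]; exact Submodule.smul_mem _ _ hx

/-- The Lie algebra map `e_β ↦ σ(∂β) ê_β` on the charges in `P`. -/
def sigmaSub (σ : SpinStructure X) (P : AddSubsemigroup Γ) :
    chargeSubalgebra (plainCoeff bd) P →ₗ⁅ℚ⁆ chargeSubalgebra (twistedCoeff bd) P where
  __ := (sigmaLie bd σ : _ →ₗ[ℚ] _).restrict (p := (chargeSubalgebra (plainCoeff bd) P).toSubmodule)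
    (q := (chargeSubalgebra (twistedCoeff bd) P).toSubmodule) (sigmaLie_mem bd σ P)
  map_lie' := by
    intro x y
    exact Subtype.ext ((sigmaLie bd σ).map_lie x.1 y.1)

/-- The induced map of enveloping algebras. -/
def sigmaEnv (σ : SpinStructure X) (P : AddSubsemigroup Γ) :
    Envelope (plainCoeff bd) P →ₐ[ℚ] Envelope (twistedCoeff bd) P :=
  UniversalEnvelopingAlgebra.lift ℚ ((UniversalEnvelopingAlgebra.ι ℚ).comp (sigmaSub bd σ P))

end Charges

/-! ### Nice multi-disk chains and their homology -/

section Disks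

/-- The rays contained in a sector `S`, as unit complex numbers. -/
def rays (S : Set ℂ) : Set ℂ := {u | u ∈ S ∧ ‖u‖ = 1}

/-- The ray of `w` comes strictly after the ray of `u` in the clockwise order of a strictly
convex sector containing both. -/
def Before (u w : ℂ) : Prop := ((starRingEnd ℂ) u * w).im < 0

variable {X : Type} [TopologicalSpace X] [ChartedSpace Plane X]
variable {Γ : Type} [AddCommGroup Γ]

variable (X) in
/-- A smooth closed curve in `X × I_S`, where `I_S` is the space of rays of `S`, parametrized
with period `1`. -/
structure Loop (S : Set ℂ) where
  pt : C(ℝ, X)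
  dir : ℝ → ℂ
  smooth_pt : ContMDiff 𝓘(ℝ, ℝ) (𝓡 2) ∞ pt
  smooth_dir : ContDiff ℝ ∞ dir
  pt_periodic : ∀ s, pt (s + 1) = pt s
  dir_periodic : ∀ s, dir (s + 1) = dir s
  dir_mem : ∀ s, dir s ∈ rays S

/-- The value on the `1`-form `f dg` of the current of integration along a closed curve. -/
def Loop.current {S : Set ℂ} (l : Loop X S) (f g : X × ℂ → ℝ) : ℝ :=
  ∫ s in (0 : ℝ)..1, f (l.pt s, l.dir s) * deriv (fun s => g (l.pt s, l.dir s)) s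

/-- Two closed curves meet at the given parameters. -/
def Meet {S : Set ℂ} (l l' : Loop X S) (s s' : ℝ) : Prop := l.pt s = l'.pt s' ∧ l.dir s = l'.dir s'

/-- Enlarging the sector. -/
def Loop.mono {S S' : Set ℂ} (h : S ⊆ S') (l : Loop X S) : Loop X S' where
  __ := l
  dir_mem s := ⟨h (l.dir_mem s).1, (l.dir_mem s).2⟩

/-- A decorated tree without edges (so a finite set `V` of vertices `v` with charges
`charge v ∈ P`), whose vertices are coloured by `J` so that the charges of the vertices of colour
`j` add up to `b j`, and a finite set `K` of closed curves distributed among the vertices: the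
curves `k` with `owner k = v` form a `1`-cycle `γ_v`. Several colours are used for tuples of trees,
one colour for a single tree. -/
structure Skeleton (P : AddSubsemigroup Γ) {J : Type} (b : J → Γ) where
  V : Type
  K : Type
  [finV : Fintype V]
  [finK : Fintype K]
  owner : K → V
  charge : V → Γ
  charge_mem : ∀ v, charge v ∈ P
  color : V → J
  total : ∀ j, (∑ v with color v = j, charge v) = b j

attribute [instance] Skeleton.finV Skeleton.finK

variable {P P' : AddSubsemigroup Γ} {J : Type} {b : J → Γ} {S : Set ℂ}

/-- The homology class of the projection to `X` of the cycle `γ_v` is `∂ (charge v)`. -/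
def Skeleton.Bounds (bd : Γ →+ H1 X) (T : Skeleton P b) (loop : T.K → Loop X S) : Prop :=
  ∀ v, Represents (∑ k with T.owner k = v, pathChain (loop k).pt) (bd (T.charge v))

/-- The cycles of two different vertices of the same colour do not intersect. -/
def Skeleton.Separated (T : Skeleton P b) (loop : T.K → Loop X S) : Prop :=
  ∀ k k', T.owner k ≠ T.owner k' → T.color (T.owner k) = T.color (T.owner k') →
    ∀ s s', ¬ Meet (loop k) (loop k') s s'

/-- The current of integration along the cycle `γ_v`. -/
def Skeleton.current (T : Skeleton P b) (loop : T.K → Loop X S) (v : T.V) (f g : X × ℂ → ℝ) : ℝ :=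
  ∑ k with T.owner k = v, (loop k).current f g

/-- The data `(T₀, {γ_v})` of a nice multi-disk `0`-chain. -/
structure Config (bd : Γ →+ H1 X) (S : Set ℂ) (P : AddSubsemigroup Γ) {J : Type} (b : J → Γ) where
  T : Skeleton P b
  loop : T.K → Loop X S
  bounds : T.Bounds bd loop
  separated : T.Separated loop

/-- The test functions on `X × ℂ`. -/
def IsTest (f : X × ℂ → ℝ) : Prop := ContMDiff ((𝓡 2).prod 𝓘(ℝ, ℂ)) 𝓘(ℝ, ℝ) ∞ f

/-- A one-parameter family of cycles `{γ_{v,t}}`, depending smoothly on the parameter. -/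
structure Isotopy (bd : Γ →+ H1 X) (S : Set ℂ) (P : AddSubsemigroup Γ) {J : Type} (b : J → Γ) where
  T : Skeleton P b
  loop : ℝ → T.K → Loop X S
  smooth_pt : ∀ k, ContMDiff 𝓘(ℝ, ℝ × ℝ) (𝓡 2) ∞ fun p : ℝ × ℝ => (loop p.1 k).pt p.2
  smooth_dir : ∀ k, ContDiff ℝ ∞ fun p : ℝ × ℝ => (loop p.1 k).dir p.2
  bounds : ∀ t, T.Bounds bd (loop t)

variable {bd : Γ →+ H1 X}

/-- The member of a family at a time when the cycles do not intersect. -/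
def Isotopy.config (H : Isotopy bd S P b) (t : ℝ) (h : H.T.Separated (H.loop t)) :
    Config bd S P b := ⟨H.T, H.loop t, H.bounds t, h⟩

/-- The component of `w` along the unit vector obtained by turning `u` clockwise by `π / 2`. -/
def clockwisePart (u w : ℂ) : ℝ := -((starRingEnd ℂ) u * w).im

/-- The determinant, for the orientation of `X` followed by the clockwise orientation of `I_S`, of
the tangent vectors of the curves `k` and `k'` at a common point and the velocity of `k` relative
to `k'` at this point. -/
def Isotopy.crossDet (H : Isotopy bd S P b) (t : ℝ) (k k' : H.T.K) (s s' : ℝ) : ℝ :=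
  let u := (H.loop t k).dir s
  let x := velocity (H.loop t k).pt s
  let y := velocity (H.loop t k').pt s'
  let z := velocity (fun r => (H.loop r k).pt s) t - velocity (fun r => (H.loop r k').pt s') t
  Matrix.det !![x 0, x 1, clockwisePart u (deriv (H.loop t k).dir s);
    y 0, y 1, clockwisePart u (deriv (H.loop t k').dir s');
    z 0, z 1, clockwisePart u
      (deriv (fun r => (H.loop r k).dir s) t - deriv (fun r => (H.loop r k').dir s') t)]

/-- For `t ∈ [0, 1]` cycles of different vertices of the same colour intersect exactly once: the
curve `k` at parameter `s` crosses the curve `k'` at parameter `s'` at time `t₀ ∈ (0, 1)`, and the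
crossing is transverse. -/
structure Isotopy.CrossesOnce (H : Isotopy bd S P b) (t₀ : ℝ) (k k' : H.T.K) (s s' : ℝ) :
    Prop where
  time_mem : t₀ ∈ Set.Ioo (0 : ℝ) 1
  left_mem : s ∈ Set.Ico (0 : ℝ) 1
  right_mem : s' ∈ Set.Ico (0 : ℝ) 1
  owner_ne : H.T.owner k ≠ H.T.owner k'
  color_eq : H.T.color (H.T.owner k) = H.T.color (H.T.owner k')
  meet : Meet (H.loop t₀ k) (H.loop t₀ k') s s'
  only : ∀ t ∈ Set.Icc (0 : ℝ) 1, ∀ l l' : H.T.K, ∀ r ∈ Set.Ico (0 : ℝ) 1,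
    ∀ r' ∈ Set.Ico (0 : ℝ) 1, H.T.owner l ≠ H.T.owner l' →
    H.T.color (H.T.owner l) = H.T.color (H.T.owner l') → Meet (H.loop t l) (H.loop t l') r r' →
    t = t₀ ∧ ((l = k ∧ l' = k' ∧ r = s ∧ r' = s') ∨ (l = k' ∧ l' = k ∧ r = s' ∧ r' = s))
  transverse : H.crossDet t₀ k k' s s' ≠ 0

/-- `C` is obtained from the cycles `loop` on `T` by replacing the vertices `v` and `w` by a single
vertex, with charge the sum of their charges and cycle the sum of their cycles. -/
structure IsMerge (T : Skeleton P b) (loop : T.K → Loop X S) (v w : T.V) (C : Config bd S P b)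
    (f : T.V → C.T.V) : Prop where
  surj : Function.Surjective f
  eq_iff : ∀ x y, f x = f y ↔ x = y ∨ (x = v ∧ y = w) ∨ (x = w ∧ y = v)
  charge_eq : ∀ y, C.T.charge y = ∑ x with f x = y, T.charge x
  color_eq : ∀ x, C.T.color (f x) = T.color x
  current_eq : ∀ y, ∀ g h : X × ℂ → ℝ, IsTest g → IsTest h →
    C.T.current C.loop y g h = ∑ x with f x = y, T.current loop x g h

/-- The space of nice multi-disk `0`-chains. -/
abbrev Chains (bd : Γ →+ H1 X) (S : Set ℂ) (P : AddSubsemigroup Γ) {J : Type} (b : J → Γ) :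
    Type 1 := Config bd S P b →₀ ℚ

/-- The relations of multi-disk homology. The first says that a chain depends on the cycles only
as currents; the other two express the boundary of an isotopy, without crossing or with one
crossing. -/
inductive IsRelator : Chains bd S P b → Prop
  | same (C C' : Config bd S P b) (e : C.T.V ≃ C'.T.V)
      (charge_eq : ∀ v, C'.T.charge (e v) = C.T.charge v)
      (color_eq : ∀ v, C'.T.color (e v) = C.T.color v)
      (current_eq : ∀ v, ∀ g h : X × ℂ → ℝ, IsTest g → IsTest h →
        C'.T.current C'.loop (e v) g h = C.T.current C.loop v g h) :
      IsRelator (Finsupp.single C' 1 - Finsupp.single C 1)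
  | isotopy (H : Isotopy bd S P b)
      (h : ∀ t ∈ Set.Icc (0 : ℝ) 1, H.T.Separated (H.loop t)) :
      IsRelator (Finsupp.single (H.config 1 (h 1 (by norm_num))) 1 -
        Finsupp.single (H.config 0 (h 0 (by norm_num))) 1)
  | crossing (H : Isotopy bd S P b) (h0 : H.T.Separated (H.loop 0))
      (h1 : H.T.Separated (H.loop 1)) (t : ℝ) (k k' : H.T.K) (s s' : ℝ)
      (hc : H.CrossesOnce t k k' s s') (C : Config bd S P b) (f : H.T.V → C.T.V)
      (hm : IsMerge H.T (H.loop t) (H.T.owner k) (H.T.owner k') C f) :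
      IsRelator (Finsupp.single (H.config 1 h1) 1 - Finsupp.single (H.config 0 h0) 1 +
        Finsupp.single C ((SignType.sign (H.crossDet t k k' s s') : SignType) : ℚ))

/-- The span of the relations. -/
def relations (bd : Γ →+ H1 X) (S : Set ℂ) (P : AddSubsemigroup Γ) {J : Type} (b : J → Γ) :
    Submodule ℚ (Chains bd S P b) := Submodule.span ℚ {x | IsRelator x}

/-- Multi-disk homology in degree `0`, for tuples of trees with charges `b j`. -/
abbrev MDHs (bd : Γ →+ H1 X) (S : Set ℂ) (P : AddSubsemigroup Γ) {J : Type} (b : J → Γ) :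
    Type 1 := Chains bd S P b ⧸ relations bd S P b

/-- Multi-disk homology `MDH₀(β; S, P)` with charges of the vertices in `P`. -/
abbrev MDH (bd : Γ →+ H1 X) (S : Set ℂ) (P : AddSubsemigroup Γ) (β : Γ) : Type 1 := MDHs bd S P fun _ : Unit => β

/-- The class of a configuration. -/
def Config.cls (C : Config bd S P b) : MDHs bd S P b :=
  (relations bd S P b).mkQ (Finsupp.single C 1)

/-- A map on configurations that respects the relations induces a map in homology. -/
def descend {M : Type 1} [AddCommGroup M] [Module ℚ M] (F : Config bd S P b → M)
    (h : ∀ r : Chains bd S P b, IsRelator r → Finsupp.linearCombination ℚ F r = 0) :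
    MDHs bd S P b →ₗ[ℚ] M :=
  (relations bd S P b).liftQ (Finsupp.linearCombination ℚ F) (by
    rw [relations, Submodule.span_le]
    exact fun r hr => h r hr)

theorem descend_cls {M : Type 1} [AddCommGroup M] [Module ℚ M] (F : Config bd S P b → M)
    (h : ∀ r : Chains bd S P b, IsRelator r → Finsupp.linearCombination ℚ F r = 0)
    (C : Config bd S P b) : descend F h C.cls = F C := by
  have : descend F h C.cls = Finsupp.linearCombination ℚ F (Finsupp.single C 1) := rfl
  rw [this]; simp

theorem lin_cls {r : Chains bd S P b} (hr : IsRelator r) :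
    Finsupp.linearCombination ℚ (Config.cls (bd := bd) (S := S) (P := P) (b := b)) r = 0 := by
  have h : (relations bd S P b).mkQ =
      Finsupp.linearCombination ℚ (Config.cls (bd := bd) (S := S) (P := P) (b := b)) := by
    refine Finsupp.lhom_ext' fun C => LinearMap.ext_ring ?_
    simp [Config.cls]
  rw [← h, Submodule.mkQ_apply, Submodule.Quotient.mk_eq_zero]
  exact Submodule.subset_span hr

theorem cls_same (C C' : Config bd S P b) (e : C.T.V ≃ C'.T.V)
    (charge_eq : ∀ v, C'.T.charge (e v) = C.T.charge v)
    (color_eq : ∀ v, C'.T.color (e v) = C.T.color v)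
    (current_eq : ∀ v, ∀ g h : X × ℂ → ℝ, IsTest g → IsTest h →
      C'.T.current C'.loop (e v) g h = C.T.current C.loop v g h) : C'.cls = C.cls := by
  simpa [sub_eq_zero] using lin_cls (IsRelator.same C C' e charge_eq color_eq current_eq)

theorem cls_isotopy (H : Isotopy bd S P b)
    (h : ∀ t ∈ Set.Icc (0 : ℝ) 1, H.T.Separated (H.loop t)) (h0 h1) :
    (H.config 1 h1).cls = (H.config 0 h0).cls := by
  simpa [sub_eq_zero] using lin_cls (IsRelator.isotopy H h)

theorem cls_crossing (H : Isotopy bd S P b) (h0 : H.T.Separated (H.loop 0))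
    (h1 : H.T.Separated (H.loop 1)) (t : ℝ) (k k' : H.T.K) (s s' : ℝ)
    (hc : H.CrossesOnce t k k' s s') (C : Config bd S P b) (f : H.T.V → C.T.V)
    (hm : IsMerge H.T (H.loop t) (H.T.owner k) (H.T.owner k') C f) :
    (H.config 1 h1).cls - (H.config 0 h0).cls +
      ((SignType.sign (H.crossDet t k k' s s') : SignType) : ℚ) • C.cls = 0 := by
  simpa using lin_cls (IsRelator.crossing H h0 h1 t k k' s s' hc C f hm)

/-- The form in which compatibility with the relations is checked. -/
theorem descend_aux {M : Type 1} [AddCommGroup M] [Module ℚ M] (F : Config bd S P b → M)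
    (same : ∀ (C C' : Config bd S P b) (e : C.T.V ≃ C'.T.V),
      (∀ v, C'.T.charge (e v) = C.T.charge v) → (∀ v, C'.T.color (e v) = C.T.color v) →
      (∀ v, ∀ g h : X × ℂ → ℝ, IsTest g → IsTest h →
        C'.T.current C'.loop (e v) g h = C.T.current C.loop v g h) → F C' = F C)
    (isotopy : ∀ (H : Isotopy bd S P b) (h0 h1),
      (∀ t ∈ Set.Icc (0 : ℝ) 1, H.T.Separated (H.loop t)) →
      F (H.config 1 h1) = F (H.config 0 h0))
    (crossing : ∀ (H : Isotopy bd S P b) (h0 h1) (t : ℝ) (k k' : H.T.K) (s s' : ℝ),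
      H.CrossesOnce t k k' s s' → ∀ (C : Config bd S P b) (f : H.T.V → C.T.V),
      IsMerge H.T (H.loop t) (H.T.owner k) (H.T.owner k') C f →
      F (H.config 1 h1) - F (H.config 0 h0) +
        ((SignType.sign (H.crossDet t k k' s s') : SignType) : ℚ) • F C = 0) :
    ∀ r : Chains bd S P b, IsRelator r → Finsupp.linearCombination ℚ F r = 0 := by
  intro r hr
  cases hr with
  | same C C' e h1 h2 h3 => simp [same C C' e h1 h2 h3]
  | isotopy H h => simp [isotopy H (h 0 (by norm_num)) (h 1 (by norm_num)) h]
  | crossing H h0 h1 t k k' s s' hc C f hm =>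
    simpa using crossing H h0 h1 t k k' s s' hc C f hm

/-! #### More charges -/

/-- Allowing more charges. -/
def Skeleton.mono (h : P ≤ P') (T : Skeleton P b) : Skeleton P' b where
  __ := T
  charge_mem v := h (T.charge_mem v)

/-- Allowing more charges. -/
def Config.mono (h : P ≤ P') (C : Config bd S P b) : Config bd S P' b :=
  ⟨C.T.mono h, C.loop, C.bounds, C.separated⟩

/-- Allowing more charges. -/
def Isotopy.mono (h : P ≤ P') (H : Isotopy bd S P b) : Isotopy bd S P' b :=
  ⟨H.T.mono h, H.loop, H.smooth_pt, H.smooth_dir, H.bounds⟩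

/-- The natural map of multi-disk homology induced by an inclusion of sets of charges. -/
def inclusion (h : P ≤ P') : MDHs bd S P b →ₗ[ℚ] MDHs bd S P' b :=
  descend (fun C => (C.mono h).cls) (descend_aux _
    (fun C C' e h1 h2 h3 => cls_same (C.mono h) (C'.mono h) e h1 h2 h3)
    (fun H h0 h1 hs => cls_isotopy (H.mono h) hs h0 h1)
    (fun H h0 h1 t k k' s s' hc C f hm =>
      cls_crossing (H.mono h) h0 h1 t k k' s s'
        ⟨hc.time_mem, hc.left_mem, hc.right_mem, hc.owner_ne, hc.color_eq, hc.meet, hc.only,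
          hc.transverse⟩ (C.mono h) f
        ⟨hm.surj, hm.eq_iff, hm.charge_eq, hm.color_eq, hm.current_eq⟩))

/-! #### Splitting a tree into a tuple of trees -/

/-- A colouring of the vertices of a tree such that the charges of colour `j` add up to `b j`. -/
def Coloring {β : Γ} (T : Skeleton P fun _ : Unit => β) (b : J → Γ) : Type :=
  {c : T.V → J // ∀ j, (∑ v with c v = j, T.charge v) = b j}

instance {β : Γ} (T : Skeleton P fun _ : Unit => β) [Fintype J] : Fintype (Coloring T b) :=
  inferInstanceAs (Fintype {c : T.V → J // ∀ j, (∑ v with c v = j, T.charge v) = b j})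

/-- The tuple of trees given by a colouring. -/
def Skeleton.recolor {β : Γ} (T : Skeleton P fun _ : Unit => β) (c : Coloring T b) :
    Skeleton P b where
  __ := T
  color := c.1
  total := c.2

/-- The tuple of trees given by a colouring. -/
def Config.recolor {β : Γ} (C : Config bd S P fun _ : Unit => β) (c : Coloring C.T b) :
    Config bd S P b :=
  ⟨C.T.recolor c, C.loop, C.bounds, fun k k' h _ => C.separated k k' h rfl⟩

/-- The tuple of trees given by a colouring. -/
def Isotopy.recolor {β : Γ} (H : Isotopy bd S P fun _ : Unit => β) (c : Coloring H.T b) :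
    Isotopy bd S P b :=
  ⟨H.T.recolor c, H.loop, H.smooth_pt, H.smooth_dir, H.bounds⟩

/-- The sum of all splittings of a configuration into a tuple with total charges `b j`. -/
def splitSum [Fintype J] (b : J → Γ) {β : Γ} (C : Config bd S P fun _ : Unit => β) :
    MDHs bd S P b := ∑ c : Coloring C.T b, (C.recolor c).cls

theorem splitSum_same [Fintype J] {β : Γ} (C C' : Config bd S P fun _ : Unit => β)
    (e : C.T.V ≃ C'.T.V)
    (h1 : ∀ v, C'.T.charge (e v) = C.T.charge v)
    (h3 : ∀ v, ∀ g h : X × ℂ → ℝ, IsTest g → IsTest h →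
      C'.T.current C'.loop (e v) g h = C.T.current C.loop v g h) :
    splitSum b C' = splitSum b C := by
  have key : ∀ (c : C'.T.V → J) (j : J),
      (∑ v with c (e v) = j, C.T.charge v) = ∑ v with c v = j, C'.T.charge v := by
    intro c j
    simp only [Finset.sum_filter]
    exact Fintype.sum_equiv e _ _ fun v => by rw [h1]
  let E : Coloring C'.T b ≃ Coloring C.T b :=
    (Equiv.arrowCongr e.symm (Equiv.refl J)).subtypeEquiv fun c => by
      refine forall_congr' fun j => ?_
      rw [← key]; rfl
  refine Fintype.sum_equiv E _ _ fun c => ?_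
  exact cls_same (C.recolor (E c)) (C'.recolor c) e h1 (fun v => rfl) h3

theorem splitSum_crossing [Fintype J] {β : Γ} (H : Isotopy bd S P fun _ : Unit => β)
    (h0 : H.T.Separated (H.loop 0)) (h1 : H.T.Separated (H.loop 1)) (t : ℝ) (k k' : H.T.K)
    (s s' : ℝ) (hc : H.CrossesOnce t k k' s s') (C : Config bd S P fun _ : Unit => β)
    (f : H.T.V → C.T.V) (hm : IsMerge H.T (H.loop t) (H.T.owner k) (H.T.owner k') C f) :
    splitSum b (H.config 1 h1) - splitSum b (H.config 0 h0) +
      ((SignType.sign (H.crossDet t k k' s s') : SignType) : ℚ) • splitSum b C = 0 := by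
  have sums : ∀ (c : C.T.V → J) (j : J),
      (∑ v with c (f v) = j, H.T.charge v) = ∑ v with c v = j, C.T.charge v := by
    intro c j
    simp only [hm.charge_eq]
    rw [Finset.sum_sigma']
    refine Finset.sum_bij' (fun v _ => ⟨f v, v⟩) (fun p _ => p.2) ?_ ?_ ?_ ?_ ?_ <;> aesop
  let E : Coloring C.T b → Coloring H.T b := fun c => ⟨fun v => c.1 (f v), fun j => by
    rw [sums]; exact c.2 j⟩
  have hinj : Function.Injective E := by
    intro c c' hcc
    refine Subtype.ext (funext fun y => ?_)
    obtain ⟨x, rfl⟩ := hm.surj y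
    exact congrFun (congrArg Subtype.val hcc) x
  have hrange : ∀ c : Coloring H.T b, c.1 (H.T.owner k) = c.1 (H.T.owner k') →
      ∃ c', E c' = c := by
    intro c hcc
    have hf : ∀ x y, f x = f y → c.1 x = c.1 y := by
      intro x y hxy
      rcases (hm.eq_iff x y).mp hxy with h | ⟨h, h'⟩ | ⟨h, h'⟩
      · rw [h]
      · rw [h, h', hcc]
      · rw [h, h', hcc]
    let c' : C.T.V → J := fun y => c.1 (hm.surj y).choose
    have hc' : ∀ x, c' (f x) = c.1 x := fun x => hf _ _ (hm.surj (f x)).choose_spec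
    refine ⟨⟨c', fun j => ?_⟩, Subtype.ext (funext hc')⟩
    rw [← sums]
    simp only [hc']
    exact c.2 j
  have hff : f (H.T.owner k) = f (H.T.owner k') := (hm.eq_iff _ _).mpr (Or.inr (Or.inl ⟨rfl, rfl⟩))
  have hC : splitSum b C = ∑ c : Coloring H.T b,
      if h : ∃ c', E c' = c then (C.recolor h.choose).cls else 0 := by
    have h2 : ∀ c' : Coloring C.T b, (C.recolor c').cls =
        (fun c : Coloring H.T b => if h : ∃ c', E c' = c then (C.recolor h.choose).cls else 0)
          (E c') := by
      intro c'
      have hex : ∃ c'', E c'' = E c' := ⟨c', rfl⟩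
      simp only [dif_pos hex]
      rw [hinj hex.choose_spec]
    rw [splitSum, Finset.sum_congr rfl fun c' _ => h2 c']
    rw [← Finset.sum_image (s := Finset.univ) (g := E)
      (f := fun c : Coloring H.T b => if h : ∃ c', E c' = c then (C.recolor h.choose).cls else 0)
      (fun _ _ _ _ h => hinj h)]
    refine Finset.sum_subset (Finset.subset_univ _) fun c _ hnot => ?_
    refine dif_neg ?_
    rintro ⟨c', rfl⟩
    exact hnot (Finset.mem_image_of_mem _ (Finset.mem_univ _))
  rw [hC]
  simp only [splitSum]
  change (∑ c : Coloring H.T b, ((H.config 1 h1).recolor c).cls) -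
    (∑ c : Coloring H.T b, ((H.config 0 h0).recolor c).cls) + _ = 0
  rw [← Finset.sum_sub_distrib, Finset.smul_sum, ← Finset.sum_add_distrib]
  refine Finset.sum_eq_zero fun c _ => ?_
  have s0 : (H.recolor c).T.Separated ((H.recolor c).loop 0) := fun k k' h _ => h0 k k' h rfl
  have s1 : (H.recolor c).T.Separated ((H.recolor c).loop 1) := fun k k' h _ => h1 k k' h rfl
  change ((H.recolor c).config 1 s1).cls - ((H.recolor c).config 0 s0).cls + _ = 0
  by_cases hcol : c.1 (H.T.owner k) = c.1 (H.T.owner k')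
  · obtain ⟨c', rfl⟩ := hrange c hcol
    have hex : ∃ c'', E c'' = E c' := ⟨c', rfl⟩
    rw [dif_pos hex, hinj hex.choose_spec]
    exact cls_crossing (H.recolor (E c')) s0 s1 t k k' s s'
      ⟨hc.time_mem, hc.left_mem, hc.right_mem, hc.owner_ne, hcol, hc.meet,
        fun t ht l l' r hr r' hr' ho _ hmeet => hc.only t ht l l' r hr r' hr' ho rfl hmeet,
        hc.transverse⟩
      (C.recolor c') f ⟨hm.surj, hm.eq_iff, hm.charge_eq, fun _ => rfl, hm.current_eq⟩
  · have hno : ¬ ∃ c', E c' = c := by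
      rintro ⟨c', rfl⟩
      exact hcol (congrArg c'.1 hff)
    rw [dif_neg hno, smul_zero, add_zero, sub_eq_zero]
    refine cls_isotopy (H.recolor c) ?_ s0 s1
    intro t' ht l l' hne hcl r r' hmeet
    have per : ∀ (l : H.T.K) (r : ℝ), (H.loop t' l).pt (Int.fract r) = (H.loop t' l).pt r ∧
        (H.loop t' l).dir (Int.fract r) = (H.loop t' l).dir r := by
      intro l r
      have h1 : Function.Periodic (H.loop t' l).pt 1 := (H.loop t' l).pt_periodic
      have h2 : Function.Periodic (H.loop t' l).dir 1 := (H.loop t' l).dir_periodic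
      have e : Int.fract r = r - ⌊r⌋ * (1 : ℝ) := by rw [mul_one]; rfl
      rw [e]
      exact ⟨h1.sub_int_mul_eq _, h2.sub_int_mul_eq _⟩
    have hmeet' : Meet (H.loop t' l) (H.loop t' l') (Int.fract r) (Int.fract r') := by
      unfold Meet
      rw [(per l r).1, (per l r).2, (per l' r').1, (per l' r').2]
      exact hmeet
    obtain ⟨_, h | h⟩ := hc.only t' ht l l' _ ⟨Int.fract_nonneg _, Int.fract_lt_one _⟩ _
      ⟨Int.fract_nonneg _, Int.fract_lt_one _⟩ hne rfl hmeet'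
    · rw [h.1, h.2.1] at hcl
      exact hcol hcl
    · rw [h.1, h.2.1] at hcl
      exact hcol hcl.symm

/-- The sum over all splittings in homology. -/
def splitMap [Fintype J] (bd : Γ →+ H1 X) (S : Set ℂ) (P : AddSubsemigroup Γ) (β : Γ)
    (b : J → Γ) : MDH bd S P β →ₗ[ℚ] MDHs bd S P b :=
  descend (splitSum b) (descend_aux _
    (fun C C' e h1 _ h3 => splitSum_same C C' e h1 h3)
    (fun H h0 h1 hs => Finset.sum_congr rfl fun c _ =>
      cls_isotopy (H.recolor c) (fun t ht k k' h _ => hs t ht k k' h rfl)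
        (fun k k' h _ => h0 k k' h rfl) (fun k k' h _ => h1 k k' h rfl))
    (fun H h0 h1 t k k' s s' hc C f hm => splitSum_crossing H h0 h1 t k k' s s' hc C f hm))

/-- The order of the group of permutations of a tuple of charges that do not change the tuple. -/
def autCard (b : J → Γ) : ℕ := Nat.card {π : Equiv.Perm J // ∀ j, b (π j) = b j}

/-- The map `𝓕` induced by the union of trees: the sum over all ways to split a tree into trees of
charges `b j`, where splittings that differ by a permutation of trees of equal charges are
counted once. -/
def factorMap [Fintype J] (bd : Γ →+ H1 X) (S : Set ℂ) (P : AddSubsemigroup Γ) (β : Γ)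
    (b : J → Γ) : MDH bd S P β →ₗ[ℚ] MDHs bd S P b :=
  ((autCard b : ℚ)⁻¹) • splitMap bd S P β b

/-! #### Unions -/

/-- Data for taking unions of configurations indexed by `J`: the `j`-th one lives in the sector
`S' j`, and its vertices get colour `q j`; configurations that get the same colour live in disjoint
sectors. -/
structure UnionData (S' : J → Set ℂ) (P' : J → AddSubsemigroup Γ) (β : J → Γ) (S : Set ℂ)
    (P : AddSubsemigroup Γ) {J' : Type} (b : J' → Γ) [Fintype J] (q : J → J') : Prop where
  sub : ∀ j, S' j ⊆ S
  le : ∀ j, P' j ≤ P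
  sep : ∀ i j, i ≠ j → q i = q j → Disjoint (S' i) (S' j)
  total : ∀ j', (∑ j with q j = j', β j) = b j'

theorem sum_sigma_fiber {M : Type} [AddCommMonoid M] {V W : J → Type}
    (F : ∀ j, V j → W j) (g : (Σ j, V j) → M) (j : J) (y : W j)
    (A : Finset (Σ j, V j)) (hA : ∀ p, p ∈ A ↔ (⟨p.1, F p.1 p.2⟩ : Σ j, W j) = ⟨j, y⟩)
    (B : Finset (V j)) (hB : ∀ x, x ∈ B ↔ F j x = y) :
    (∑ p ∈ A, g p) = ∑ x ∈ B, g ⟨j, x⟩ := by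
  refine (Finset.sum_bij (fun x _ => (⟨j, x⟩ : Σ j, V j)) ?_ ?_ ?_ ?_).symm
  · intro x hx
    rw [hA, (hB x).mp hx]
  · intro x _ x' _ h
    exact eq_of_heq (Sigma.mk.inj h).2
  · rintro ⟨j', x⟩ h
    rw [hA] at h
    obtain ⟨rfl, h⟩ := Sigma.mk.inj h
    exact ⟨x, (hB x).mpr (eq_of_heq h), rfl⟩
  · intro x _
    rfl

section Union

variable [Fintype J] {S' : J → Set ℂ} {Q' : J → AddSubsemigroup Γ} {β : J → Γ} {J' : Type}
  {b' : J' → Γ} {q : J → J'}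

/-- The disjoint union of trees without edges. -/
def Skeleton.union (u : UnionData S' Q' β S P b' q)
    (T : ∀ j, Skeleton (Q' j) fun _ : Unit => β j) : Skeleton P b' where
  V := Σ j, (T j).V
  K := Σ j, (T j).K
  owner k := ⟨k.1, (T k.1).owner k.2⟩
  charge v := (T v.1).charge v.2
  charge_mem v := u.le v.1 ((T v.1).charge_mem v.2)
  color v := q v.1
  total j' := by
    rw [← u.total j', Finset.sum_filter, Finset.sum_filter, Fintype.sum_sigma]
    refine Finset.sum_congr rfl fun j _ => ?_
    dsimp only
    split_ifs
    · refine Eq.trans ?_ ((T j).total ())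
      exact Finset.sum_congr (by ext; simp) fun _ _ => rfl
    · simp

/-- The closed curves of a disjoint union. -/
def unionLoop (u : UnionData S' Q' β S P b' q) (T : ∀ j, Skeleton (Q' j) fun _ : Unit => β j)
    (loop : ∀ j, (T j).K → Loop X (S' j)) : (Skeleton.union u T).K → Loop X S :=
  fun k => (loop k.1 k.2).mono (u.sub k.1)

theorem union_bounds (u : UnionData S' Q' β S P b' q)
    (T : ∀ j, Skeleton (Q' j) fun _ : Unit => β j)
    (loop : ∀ j, (T j).K → Loop X (S' j)) (h : ∀ j, (T j).Bounds bd (loop j)) :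
    (Skeleton.union u T).Bounds bd (unionLoop u T loop) := by
  rintro ⟨j, v⟩
  have := sum_sigma_fiber (M := (singularChains X).X 1) (fun j => (T j).owner)
    (fun k => pathChain (loop k.1 k.2).pt) j v
    (Finset.univ.filter fun k : (Skeleton.union u T).K =>
      (Skeleton.union u T).owner k = ⟨j, v⟩) (fun p => Finset.mem_filter.trans (and_iff_right (Finset.mem_univ _)))
    (Finset.univ.filter fun k => (T j).owner k = v) (fun p => by simp)
  have h' := h j v
  rw [← this] at h'
  exact h'

theorem union_current (u : UnionData S' Q' β S P b' q)
    (T : ∀ j, Skeleton (Q' j) fun _ : Unit => β j)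
    (loop : ∀ j, (T j).K → Loop X (S' j)) (j : J) (v : (T j).V) (g h : X × ℂ → ℝ) :
    (Skeleton.union u T).current (unionLoop u T loop) ⟨j, v⟩ g h =
      (T j).current (loop j) v g h := by
  exact sum_sigma_fiber (fun j => (T j).owner) (fun k => (loop k.1 k.2).current g h) j v
    (Finset.univ.filter fun k : (Skeleton.union u T).K =>
      (Skeleton.union u T).owner k = ⟨j, v⟩) (fun p => Finset.mem_filter.trans (and_iff_right (Finset.mem_univ _)))
    (Finset.univ.filter fun k => (T j).owner k = v) (fun p => by simp)

theorem union_meet (u : UnionData S' Q' β S P b' q)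
    (T : ∀ j, Skeleton (Q' j) fun _ : Unit => β j)
    (loop : ∀ j, (T j).K → Loop X (S' j)) {k k' : (Skeleton.union u T).K} (hk : k.1 ≠ k'.1)
    (hq : q k.1 = q k'.1) (s s' : ℝ) :
    ¬ Meet (unionLoop u T loop k) (unionLoop u T loop k') s s' := by
  rintro ⟨_, h⟩
  have h1 := ((loop k.1 k.2).dir_mem s).1
  have h2 := ((loop k'.1 k'.2).dir_mem s').1
  have h3 : (loop k.1 k.2).dir s = (loop k'.1 k'.2).dir s' := h
  rw [h3] at h1
  exact Set.disjoint_left.mp (u.sep _ _ hk hq) h1 h2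

theorem union_separated (u : UnionData S' Q' β S P b' q)
    (T : ∀ j, Skeleton (Q' j) fun _ : Unit => β j)
    (loop : ∀ j, (T j).K → Loop X (S' j)) (h : ∀ j, (T j).Separated (loop j)) :
    (Skeleton.union u T).Separated (unionLoop u T loop) := by
  rintro ⟨j, k⟩ ⟨j', k'⟩ hne hcol s s' hmeet
  by_cases hj : j = j'
  · subst hj
    exact h j k k' (fun e => hne (congrArg (Sigma.mk j) e)) rfl s s' hmeet
  · exact union_meet u T loop (k := ⟨j, k⟩) (k' := ⟨j', k'⟩) hj hcol s s' hmeet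

/-- The disjoint union of configurations. -/
def Config.union (u : UnionData S' Q' β S P b' q)
    (C : ∀ j, Config bd (S' j) (Q' j) fun _ : Unit => β j) : Config bd S P b' :=
  ⟨Skeleton.union u fun j => (C j).T, unionLoop u (fun j => (C j).T) fun j => (C j).loop,
    union_bounds u _ _ fun j => (C j).bounds, union_separated u _ _ fun j => (C j).separated⟩

/-- The disjoint union of isotopies. -/
def Isotopy.union (u : UnionData S' Q' β S P b' q)
    (H : ∀ j, Isotopy bd (S' j) (Q' j) fun _ : Unit => β j) : Isotopy bd S P b' where
  T := Skeleton.union u fun j => (H j).T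
  loop t := unionLoop u (fun j => (H j).T) fun j => (H j).loop t
  smooth_pt k := (H k.1).smooth_pt k.2
  smooth_dir k := (H k.1).smooth_dir k.2
  bounds t := union_bounds u _ _ fun j => (H j).bounds t

/-- A constant isotopy. -/
def Config.const (C : Config bd S P b) : Isotopy bd S P b where
  T := C.T
  loop _ := C.loop
  smooth_pt k := (C.loop k).smooth_pt.comp contDiff_snd.contMDiff
  smooth_dir k := (C.loop k).smooth_dir.comp contDiff_snd
  bounds _ := C.bounds

theorem union_crossing (u : UnionData S' Q' β S P b' q)
    (H : ∀ j, Isotopy bd (S' j) (Q' j) fun _ : Unit => β j) (j₀ : J)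
    (hconst : ∀ j, j ≠ j₀ → ∀ t, (H j).loop t = (H j).loop 0)
    (h0 : ∀ j, (H j).T.Separated ((H j).loop 0)) (h1 : ∀ j, (H j).T.Separated ((H j).loop 1))
    (t : ℝ) (k k' : (H j₀).T.K) (s s' : ℝ) (hc : (H j₀).CrossesOnce t k k' s s')
    (C : ∀ j, Config bd (S' j) (Q' j) fun _ : Unit => β j) (F : ∀ j, (H j).T.V → (C j).T.V)
    (hm : IsMerge (H j₀).T ((H j₀).loop t) ((H j₀).T.owner k) ((H j₀).T.owner k') (C j₀) (F j₀))
    (hF : ∀ j, j ≠ j₀ → Function.Bijective (F j) ∧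
      (∀ v, (C j).T.charge (F j v) = (H j).T.charge v) ∧
      ∀ v, ∀ g h : X × ℂ → ℝ, IsTest g → IsTest h →
        (C j).T.current (C j).loop (F j v) g h = (H j).T.current ((H j).loop 0) v g h) :
    (Config.union u fun j => (H j).config 1 (h1 j)).cls -
      (Config.union u fun j => (H j).config 0 (h0 j)).cls +
      ((SignType.sign ((H j₀).crossDet t k k' s s') : SignType) : ℚ) • (Config.union u C).cls
      = 0 := by
  have fiber : ∀ j, j ≠ j₀ → ∀ (g : (H j).T.V → Γ) (y : (H j).T.V),
      (∑ x with F j x = F j y, g x) = g y := by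
    intro j hj g y
    rw [Finset.sum_eq_single_of_mem y (by simp)]
    intro x hx hxy
    exact absurd ((hF j hj).1.1 (by simpa using hx)) hxy
  have fiber' : ∀ j, j ≠ j₀ → ∀ (g : (H j).T.V → ℝ) (y : (H j).T.V),
      (∑ x with F j x = F j y, g x) = g y := by
    intro j hj g y
    rw [Finset.sum_eq_single_of_mem y (by simp)]
    intro x hx hxy
    exact absurd ((hF j hj).1.1 (by simpa using hx)) hxy
  refine cls_crossing (Isotopy.union u H) (union_separated u _ _ h0) (union_separated u _ _ h1) t
    ⟨j₀, k⟩ ⟨j₀, k'⟩ s s' ?_ (Config.union u C) (fun p => ⟨p.1, F p.1 p.2⟩) ?_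
  · refine ⟨hc.time_mem, hc.left_mem, hc.right_mem, ?_, rfl, hc.meet, ?_, hc.transverse⟩
    · intro h
      exact hc.owner_ne (eq_of_heq (Sigma.mk.inj h).2)
    · rintro t' ht' ⟨j, l⟩ ⟨j', l'⟩ r hr r' hr' hne hcol hmeet
      by_cases hj : j = j'
      · subst hj
        by_cases hj0 : j = j₀
        · subst hj0
          obtain ⟨h, h'⟩ := hc.only t' ht' l l' r hr r' hr'
            (fun e => hne (congrArg (Sigma.mk j) e)) rfl hmeet
          refine ⟨h, ?_⟩
          rcases h' with ⟨rfl, rfl, rfl, rfl⟩ | ⟨rfl, rfl, rfl, rfl⟩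
          · exact Or.inl ⟨rfl, rfl, rfl, rfl⟩
          · exact Or.inr ⟨rfl, rfl, rfl, rfl⟩
        · exfalso
          have hmeet' : Meet ((H j).loop t' l) ((H j).loop t' l') r r' := hmeet
          rw [hconst j hj0 t'] at hmeet'
          exact h0 j l l' (fun e => hne (congrArg (Sigma.mk j) e)) rfl r r' hmeet'
      · exact absurd hmeet (union_meet u (fun j => (H j).T) (fun j => (H j).loop t')
          (k := ⟨j, l⟩) (k' := ⟨j', l'⟩) hj hcol r r')
  · refine ⟨?_, ?_, ?_, fun _ => rfl, ?_⟩
    · rintro ⟨j, y⟩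
      by_cases hj : j = j₀
      · subst hj
        obtain ⟨x, rfl⟩ := hm.surj y
        exact ⟨⟨j, x⟩, rfl⟩
      · obtain ⟨x, rfl⟩ := (hF j hj).1.2 y
        exact ⟨⟨j, x⟩, rfl⟩
    · rintro ⟨i, x⟩ ⟨j, y⟩
      constructor
      · intro h
        obtain ⟨rfl, h⟩ := Sigma.mk.inj h
        have h := eq_of_heq h
        by_cases hj : i = j₀
        · subst hj
          rcases (hm.eq_iff x y).mp h with rfl | ⟨rfl, rfl⟩ | ⟨rfl, rfl⟩
          · exact Or.inl rfl
          · exact Or.inr (Or.inl ⟨rfl, rfl⟩)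
          · exact Or.inr (Or.inr ⟨rfl, rfl⟩)
        · exact Or.inl (congrArg (Sigma.mk i) ((hF i hj).1.1 h))
      · have e : F j₀ ((H j₀).T.owner k) = F j₀ ((H j₀).T.owner k') :=
          (hm.eq_iff _ _).mpr (Or.inr (Or.inl ⟨rfl, rfl⟩))
        rintro (h | ⟨h, h'⟩ | ⟨h, h'⟩)
        · rw [h]
        · rw [h, h']; exact congrArg (Sigma.mk j₀) e
        · rw [h, h']; exact congrArg (Sigma.mk j₀) e.symm
    · rintro ⟨j, y⟩
      refine Eq.trans ?_ (sum_sigma_fiber F (fun p => (H p.1).T.charge p.2) j y _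
        (fun p => (@Finset.mem_filter _ _ (fun _ => Classical.propDecidable _) _ _).trans (and_iff_right (Finset.mem_univ _)))
        (Finset.univ.filter fun x => F j x = y) (fun x => by simp)).symm
      change (C j).T.charge y = _
      by_cases hj : j = j₀
      · subst hj
        exact hm.charge_eq y
      · obtain ⟨x, rfl⟩ := (hF j hj).1.2 y
        rw [fiber j hj fun x => (H j).T.charge x]
        exact (hF j hj).2.1 x
    · rintro ⟨j, y⟩ g h hg hh
      refine Eq.trans ?_ (sum_sigma_fiber F
        (fun p => (Isotopy.union u H).T.current ((Isotopy.union u H).loop t) p g h) j y _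
        (fun p => (@Finset.mem_filter _ _ (fun _ => Classical.propDecidable _) _ _).trans (and_iff_right (Finset.mem_univ _)))
        (Finset.univ.filter fun x => F j x = y) (fun x => by simp)).symm
      refine (union_current u (fun j => (C j).T) (fun j => (C j).loop) j y g h).trans ?_
      have e : ∀ x, (Isotopy.union u H).T.current ((Isotopy.union u H).loop t) ⟨j, x⟩ g h =
          (H j).T.current ((H j).loop t) x g h := fun x =>
        union_current u (fun j => (H j).T) (fun j => (H j).loop t) j x g h
      simp only [e]
      by_cases hj : j = j₀
      · subst hj
        exact hm.current_eq y g h hg hh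
      · obtain ⟨x, rfl⟩ := (hF j hj).1.2 y
        rw [fiber' j hj fun x => (H j).T.current ((H j).loop t) x g h, hconst j hj t]
        exact (hF j hj).2.2 x g h hg hh

theorem union_update (u : UnionData S' Q' β S P b' q)
    (C : ∀ j, Config bd (S' j) (Q' j) fun _ : Unit => β j) (j₀ : J)
    (r : Chains bd (S' j₀) (Q' j₀) fun _ : Unit => β j₀) (hr : IsRelator r) :
    Finsupp.linearCombination ℚ
      (fun D => (Config.union u (Function.update C j₀ D)).cls) r = 0 := by
  refine descend_aux _ ?_ ?_ ?_ r hr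
  · intro D D' e h1 _ h3
    have : ∀ j, ∃ f : (Function.update C j₀ D j).T.V ≃ (Function.update C j₀ D' j).T.V,
        (∀ v, (Function.update C j₀ D' j).T.charge (f v) =
          (Function.update C j₀ D j).T.charge v) ∧
        ∀ v, ∀ g h : X × ℂ → ℝ, IsTest g → IsTest h →
          (Function.update C j₀ D' j).T.current (Function.update C j₀ D' j).loop (f v) g h =
          (Function.update C j₀ D j).T.current (Function.update C j₀ D j).loop v g h := by
      intro j
      by_cases hj : j = j₀
      · subst hj
        rw [Function.update_self, Function.update_self]
        exact ⟨e, h1, h3⟩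
      · rw [Function.update_of_ne hj, Function.update_of_ne hj]
        exact ⟨Equiv.refl _, fun _ => rfl, fun _ _ _ _ _ => rfl⟩
    choose f hf1 hf2 using this
    refine cls_same _ _ (Equiv.sigmaCongrRight f) (fun v => hf1 v.1 v.2) (fun v => rfl) ?_
    rintro ⟨j, v⟩ g h hg hh
    exact (union_current u (fun j => (Function.update C j₀ D' j).T)
        (fun j => (Function.update C j₀ D' j).loop) j (f j v) g h).trans
      ((hf2 j v g h hg hh).trans (union_current u (fun j => (Function.update C j₀ D j).T)
        (fun j => (Function.update C j₀ D j).loop) j v g h).symm)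
  · intro H h0 h1 hs
    have hsep : ∀ t ∈ Set.Icc (0 : ℝ) 1, ∀ j,
        (Function.update (fun j => (C j).const) j₀ H j).T.Separated
          ((Function.update (fun j => (C j).const) j₀ H j).loop t) := by
      intro t ht j
      by_cases hj : j = j₀
      · subst hj
        rw [Function.update_self]
        exact hs t ht
      · rw [Function.update_of_ne hj]
        exact (C j).separated
    have e : ∀ t (ht : t ∈ Set.Icc (0 : ℝ) 1) (h : H.T.Separated (H.loop t)),
        Function.update C j₀ (H.config t h) = fun j =>
          (Function.update (fun j => (C j).const) j₀ H j).config t (hsep t ht j) := by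
      intro t ht h
      funext j
      by_cases hj : j = j₀
      · subst hj
        simp
      · rw [Function.update_of_ne hj]
        simp only [Function.update_of_ne hj]
        rfl
    rw [e 0 (by norm_num) h0, e 1 (by norm_num) h1]
    exact cls_isotopy (Isotopy.union u (Function.update (fun j => (C j).const) j₀ H))
      (fun t ht => union_separated u _ _ (hsep t ht))
      (union_separated u _ _ (hsep 0 (by norm_num))) (union_separated u _ _ (hsep 1 (by norm_num)))
  · intro H h0 h1 t k k' s s' hc D f hm
    have key : ∀ (H' : ∀ j, Isotopy bd (S' j) (Q' j) fun _ : Unit => β j) (hH : H' j₀ = H)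
        (hH' : ∀ j, j ≠ j₀ → H' j = (C j).const)
        (D' : ∀ j, Config bd (S' j) (Q' j) fun _ : Unit => β j) (hD : D' j₀ = D)
        (hD' : ∀ j, j ≠ j₀ → D' j = C j),
        (Config.union u (Function.update C j₀ (H.config 1 h1))).cls -
          (Config.union u (Function.update C j₀ (H.config 0 h0))).cls +
          ((SignType.sign (H.crossDet t k k' s s') : SignType) : ℚ) •
            (Config.union u D').cls = 0 := by
      intro H' hH hH' D' hD hD'
      subst hH
      subst hD
      have h0' : ∀ j, (H' j).T.Separated ((H' j).loop 0) := by
        intro j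
        by_cases hj : j = j₀
        · subst hj; exact h0
        · rw [hH' j hj]; exact (C j).separated
      have h1' : ∀ j, (H' j).T.Separated ((H' j).loop 1) := by
        intro j
        by_cases hj : j = j₀
        · subst hj; exact h1
        · rw [hH' j hj]; exact (C j).separated
      have e0 : Function.update C j₀ ((H' j₀).config 0 h0) = fun j => (H' j).config 0 (h0' j) := by
        funext j
        by_cases hj : j = j₀
        · subst hj; simp
        · simp only [Function.update_of_ne hj, hH' j hj]; rfl
      have e1 : Function.update C j₀ ((H' j₀).config 1 h1) = fun j => (H' j).config 1 (h1' j) := by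
        funext j
        by_cases hj : j = j₀
        · subst hj; simp
        · simp only [Function.update_of_ne hj, hH' j hj]; rfl
      have hex : ∀ j, ∃ F : (H' j).T.V → (D' j).T.V, (∀ hj : j = j₀, HEq F f) ∧
          (j ≠ j₀ → Function.Bijective F ∧
            (∀ v, (D' j).T.charge (F v) = (H' j).T.charge v) ∧
            ∀ v, ∀ g h : X × ℂ → ℝ, IsTest g → IsTest h →
              (D' j).T.current (D' j).loop (F v) g h =
                (H' j).T.current ((H' j).loop 0) v g h) := by
        intro j
        by_cases hj : j = j₀
        · subst hj
          exact ⟨f, fun _ => HEq.rfl, fun h => absurd rfl h⟩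
        · rw [hH' j hj, hD' j hj]
          exact ⟨id, fun h => absurd h hj, fun _ => ⟨Function.bijective_id, fun _ => rfl,
            fun _ _ _ _ _ => rfl⟩⟩
      choose F hF1 hF2 using hex
      have hFf : F j₀ = f := eq_of_heq (hF1 j₀ rfl)
      rw [e0, e1]
      refine union_crossing u H' j₀ ?_ h0' h1' t k k' s s' hc D' F (hFf ▸ hm) hF2
      intro j hj t
      rw [hH' j hj]
      rfl
    exact key (Function.update (fun j => (C j).const) j₀ H) (Function.update_self ..)
      (fun j hj => Function.update_of_ne hj ..) _ (Function.update_self ..)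
      (fun j hj => Function.update_of_ne hj ..)

/-- The class of the union of chains. -/
def unionChain (bd : Γ →+ H1 X) (u : UnionData S' Q' β S P b' q) :
    MultilinearMap ℚ (fun j => Chains bd (S' j) (Q' j) fun _ : Unit => β j) (MDHs bd S P b') :=
  (((Basis.piTensorProduct fun _ : J => Finsupp.basisSingleOne).constr ℚ
    fun C => (Config.union u C).cls) : _ →ₗ[ℚ] MDHs bd S P b').compMultilinearMap
      (PiTensorProduct.tprod ℚ)

theorem unionChain_single (u : UnionData S' Q' β S P b' q)
    (C : ∀ j, Config bd (S' j) (Q' j) fun _ : Unit => β j) :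
    unionChain bd u (fun j => Finsupp.single (C j) 1) = (Config.union u C).cls := by
  have h := (Basis.piTensorProduct fun j : J => Finsupp.basisSingleOne (R := ℚ)
    (ι := Config bd (S' j) (Q' j) fun _ : Unit => β j)).constr_basis ℚ
      (fun C => (Config.union u C).cls) C
  rw [Basis.piTensorProduct_apply] at h
  simp only [Finsupp.coe_basisSingleOne] at h
  exact h

theorem unionChain_relation (u : UnionData S' Q' β S P b' q)
    (w : ∀ j, Chains bd (S' j) (Q' j) fun _ : Unit => β j) (j₀ : J)
    (r : Chains bd (S' j₀) (Q' j₀) fun _ : Unit => β j₀)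
    (hr : r ∈ relations bd (S' j₀) (Q' j₀) fun _ : Unit => β j₀) :
    unionChain bd u (Function.update w j₀ r) = 0 := by
  have hsub : relations bd (S' j₀) (Q' j₀) (fun _ : Unit => β j₀) ≤
      LinearMap.ker ((unionChain bd u).toLinearMap w j₀) := by
    rw [relations, Submodule.span_le]
    intro r hr
    change unionChain bd u (Function.update w j₀ r) = 0
    let φ : ∀ j, Chains bd (S' j) (Q' j) (fun _ : Unit => β j) →ₗ[ℚ]
        Chains bd (S' j) (Q' j) (fun _ : Unit => β j) :=
      Function.update (fun _ => LinearMap.id) j₀ (Finsupp.linearCombination ℚ fun _ => r)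
    have hφ : (unionChain bd u).compLinearMap φ = 0 := by
      refine Module.Basis.ext_multilinear (fun j => Finsupp.basisSingleOne) fun C => ?_
      have e1 : (fun j => φ j (Finsupp.basisSingleOne (C j))) =
          Function.update (fun j => Finsupp.single (C j) (1 : ℚ)) j₀ r := by
        funext j
        by_cases hj : j = j₀
        · subst hj; simp [φ]
        · simp [φ, Function.update_of_ne hj]
      rw [MultilinearMap.compLinearMap_apply, e1, zero_apply]
      have e2 : (unionChain bd u).toLinearMap (fun j => Finsupp.single (C j) (1 : ℚ)) j₀ =
          Finsupp.linearCombination ℚ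
            (fun D => (Config.union u (Function.update C j₀ D)).cls) := by
        refine Finsupp.lhom_ext' fun D => LinearMap.ext_ring ?_
        rw [LinearMap.comp_apply, LinearMap.comp_apply, Finsupp.lsingle_apply,
          Finsupp.linearCombination_single, one_smul, ← unionChain_single u,
          MultilinearMap.toLinearMap_apply]
        congr 1
        funext j
        by_cases hj : j = j₀
        · subst hj; simp
        · simp [Function.update_of_ne hj]
      have e3 := union_update u C j₀ r hr
      rw [← e2, MultilinearMap.toLinearMap_apply] at e3
      exact e3
    by_cases hne : Nonempty (Config bd (S' j₀) (Q' j₀) fun _ : Unit => β j₀)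
    · obtain ⟨D⟩ := hne
      have h := congrArg (fun m => m (Function.update w j₀ (Finsupp.single D 1))) hφ
      simp only [MultilinearMap.compLinearMap_apply, zero_apply] at h
      rw [← h]
      congr 1
      funext j
      by_cases hj : j = j₀
      · subst hj; simp [φ]
      · simp [φ, Function.update_of_ne hj]
    · have : r = 0 := by
        ext D
        exact absurd ⟨D⟩ hne
      rw [this]
      exact (unionChain bd u).map_update_zero w j₀
  exact hsub hr

/-- The class of the union of multi-disk chains with given classes. -/
def unionClass (u : UnionData S' Q' β S P b' q) (W : ∀ j, MDH bd (S' j) (Q' j) (β j)) :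
    MDHs bd S P b' :=
  unionChain bd u fun j => Function.surjInv (Submodule.mkQ_surjective _) (W j)

/-- The class of the union does not depend on the chains that represent the given classes. -/
theorem unionClass_mk (u : UnionData S' Q' β S P b' q)
    (w : ∀ j, Chains bd (S' j) (Q' j) fun _ : Unit => β j) :
    unionClass u (fun j => (relations bd (S' j) (Q' j) fun _ : Unit => β j).mkQ (w j)) =
      unionChain bd u w := by
  have key : ∀ (A : Finset J) (v w : ∀ j, Chains bd (S' j) (Q' j) fun _ : Unit => β j),
      (∀ j ∈ A, v j - w j ∈ relations bd (S' j) (Q' j) fun _ : Unit => β j) →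
      (∀ j, j ∉ A → v j = w j) → unionChain bd u v = unionChain bd u w := by
    intro A
    induction A using Finset.induction_on with
    | empty =>
      intro v w _ h
      rw [show v = w from funext fun j => h j (by simp)]
    | insert a A ha ih =>
      intro v w h1 h2
      have e : unionChain bd u v = unionChain bd u (Function.update v a (w a)) := by
        have h3 : v = Function.update v a ((v a - w a) + w a) := by simp
        conv_lhs => rw [h3]
        rw [MultilinearMap.map_update_add,
          unionChain_relation u v a _ (h1 a (Finset.mem_insert_self a A)), zero_add]
      rw [e]
      refine ih _ _ ?_ ?_
      · intro j hj
        have hja : j ≠ a := fun h => ha (h ▸ hj)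
        rw [Function.update_of_ne hja]
        exact h1 j (Finset.mem_insert_of_mem hj)
      · intro j hj
        by_cases hja : j = a
        · subst hja; simp
        · rw [Function.update_of_ne hja]
          exact h2 j (by simp [hja, hj])
  refine key Finset.univ _ _ (fun j _ => ?_) fun j h => absurd (Finset.mem_univ j) h
  rw [← Submodule.Quotient.mk_eq_zero, Submodule.Quotient.mk_sub, sub_eq_zero]
  exact Function.surjInv_eq (Submodule.mkQ_surjective _) _

end Union

/-! #### The natural map to the enveloping algebra -/

/-- The characteristic properties of the natural isomorphism from multi-disk homology to the
graded pieces of the enveloping algebra: if the cycle of each vertex `v` is supported over a single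
ray `d v`, and the rays are in clockwise order along the list `[v₀, …, vᵣ]` of all the vertices,
then the value is `e_{β₀} ⋯ e_{βᵣ}`, `βᵢ = charge vᵢ`; and it is natural in the set of charges. -/
structure IsNaturalMap (bd : Γ →+ H1 X) (S : Set ℂ)
    (Φ : ∀ (P : AddSubsemigroup Γ) (β : Γ),
      MDH bd S P β →ₗ[ℚ] gradedPiece (plainCoeff bd) P β) : Prop where
  ordered : ∀ (P : AddSubsemigroup Γ) (β : Γ) (C : Config bd S P fun _ : Unit => β)
    (l : List C.T.V), l.Nodup → (∀ v, v ∈ l) →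
    ∀ d : C.T.V → ℂ, (∀ v, d v ∈ rays S) → (∀ k s, (C.loop k).dir s = d (C.T.owner k)) →
    l.Pairwise (fun v w => Before (d v) (d w)) →
    (Φ P β C.cls : Envelope (plainCoeff bd) P) =
      (l.map fun v => envGen (plainCoeff bd) P ⟨C.T.charge v, C.T.charge_mem v⟩).prod
  natural : ∀ (P P' : AddSubsemigroup Γ) (h : P ≤ P') (β : Γ) (W : MDH bd S P β),
    envIncl (plainCoeff bd) h (Φ P β W) = (Φ P' β (inclusion h W) : Envelope (plainCoeff bd) P')

/-- The natural isomorphism from `MDH₀(β; S, P)` to the graded piece of degree `β` of the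
enveloping algebra; it is determined by its characteristic properties, as the configurations
whose cycles are supported over single rays generate. -/
def toEnvelope (bd : Γ →+ H1 X) (S : Set ℂ) (P : AddSubsemigroup Γ) (β : Γ) :
    MDH bd S P β →ₗ[ℚ] gradedPiece (plainCoeff bd) P β :=
  if h : ∃ Φ, IsNaturalMap bd S Φ then h.choose P β else 0

theorem sigmaEnv_envGen (bd : Γ →+ H1 X) (σ : SpinStructure X) (P : AddSubsemigroup Γ) (β : P) :
    sigmaEnv bd σ P (envGen (plainCoeff bd) P β) =
      (((σ.toFun (bd β) : ℤˣ) : ℤ) : ℚ) • envGen (twistedCoeff bd) P β := by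
  unfold sigmaEnv envGen
  rw [UniversalEnvelopingAlgebra.lift_ι_apply, LieHom.comp_apply, ← map_smul]
  congr 1
  exact Subtype.ext (lieLift_gen (plainCoeff bd)
    (fun β => (((σ.toFun (bd β) : ℤˣ) : ℤ) : ℚ) • gen (twistedCoeff bd) β) β.1)

theorem sigmaEnv_mem (bd : Γ →+ H1 X) (σ : SpinStructure X) (P : AddSubsemigroup Γ) (β : Γ)
    (x : Envelope (plainCoeff bd) P) (hx : x ∈ gradedPiece (plainCoeff bd) P β) :
    sigmaEnv bd σ P x ∈ gradedPiece (twistedCoeff bd) P β := by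
  induction hx using Submodule.span_induction with
  | zero => rw [map_zero]; exact Submodule.zero_mem _
  | add x y _ _ hx hy => rw [map_add]; exact Submodule.add_mem _ hx hy
  | smul r x _ hx => rw [map_smul]; exact Submodule.smul_mem _ _ hx
  | mem x h =>
    obtain ⟨l, hl, rfl⟩ := h
    have key : ∀ l : List P, ∃ r : ℚ, sigmaEnv bd σ P (l.map (envGen (plainCoeff bd) P)).prod =
        r • (l.map (envGen (twistedCoeff bd) P)).prod := by
      intro l
      induction l with
      | nil => exact ⟨1, by simp⟩
      | cons a l ih =>
        obtain ⟨r, hr⟩ := ih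
        refine ⟨(((σ.toFun (bd a) : ℤˣ) : ℤ) : ℚ) * r, ?_⟩
        rw [List.map_cons, List.prod_cons, map_mul, hr, sigmaEnv_envGen, List.map_cons,
          List.prod_cons, smul_mul_smul_comm]
    obtain ⟨r, hr⟩ := key l
    rw [hr]
    exact Submodule.smul_mem _ _ (Submodule.subset_span ⟨l, hl, rfl⟩)

end Disks

/-! ### String stability structures -/

section Stability

/-- A strictly convex sector of the plane with vertex at the origin (and not containing it); parts
of its boundary may or may not belong to it. -/
structure IsSector (S : Set ℂ) : Prop where
  convex : Convex ℝ S
  cone : ∀ z ∈ S, ∀ r : ℝ, 0 < r → r • z ∈ S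
  zero_notMem : (0 : ℂ) ∉ S
  interior_nonempty : (interior S).Nonempty
  strict : ∃ w : ℂ, ∀ z ∈ closure S, z ≠ 0 → 0 < ((starRingEnd ℂ) w * z).re

variable {X : Type} [TopologicalSpace X] [ChartedSpace Plane X]
variable {Γ : Type} [AddCommGroup Γ]

/-- The set `Γ(S, Z, Q)` without `0`: sums of one or more `β` with `Z β ∈ S` and `Q β ≥ 0`. -/
def charges (Q : QuadraticForm ℝ (ℝ ⊗[ℤ] Γ)) (Z : Γ →+ ℂ) (S : Set ℂ) : AddSubsemigroup Γ :=
  AddSubsemigroup.closure {β | Z β ∈ S ∧ 0 ≤ Q (1 ⊗ₜ β)}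

theorem charges_mono (Q : QuadraticForm ℝ (ℝ ⊗[ℤ] Γ)) (Z : Γ →+ ℂ) {S S' : Set ℂ} (h : S ⊆ S') :
    charges Q Z S ≤ charges Q Z S' :=
  AddSubsemigroup.closure_mono fun _ hβ => ⟨h hβ.1, hβ.2⟩

/-- The data for the cup product of classes in the same sector, which goes to tuples of trees. -/
theorem cupData (S : Set ℂ) (P : AddSubsemigroup Γ) {J : Type} [Fintype J] (b : J → Γ) :
    UnionData (fun _ => S) (fun _ => P) b S P b id where
  sub _ := subset_rfl
  le _ := le_rfl
  sep _ _ h h' := absurd h' h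
  total j' := by
    rw [Finset.sum_filter]
    exact (Finset.sum_eq_single j' (fun _ _ h => if_neg h) (by simp)).trans (if_pos rfl)

/-- The data for the product of classes in two disjoint sectors, which goes to single trees. -/
theorem sectorData (Q : QuadraticForm ℝ (ℝ ⊗[ℤ] Γ)) (Z : Γ →+ ℂ) {S : Set ℂ} {S' : Fin 2 → Set ℂ}
    (hS : S = S' 0 ∪ S' 1) (hd : Disjoint (S' 0) (S' 1)) {β : Γ} (b : Fin 2 → Γ)
    (hb : b 0 + b 1 = β) :
    UnionData S' (fun i => charges Q Z (S' i)) b S (charges Q Z S) (fun _ : Unit => β)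
      (fun _ => ()) where
  sub i := by
    rw [hS]
    fin_cases i
    · exact Set.subset_union_left
    · exact Set.subset_union_right
  le i := charges_mono Q Z (by
    rw [hS]
    fin_cases i
    · exact Set.subset_union_left
    · exact Set.subset_union_right)
  sep i j h _ := by
    fin_cases i <;> fin_cases j
    · exact absurd rfl h
    · exact hd
    · exact hd.symm
    · exact absurd rfl h
  total _ := by simp [Fin.sum_univ_two, hb]

/-- A string stability structure on the charges `Γ`, with fixed quadratic form `Q`: a central charge
`Z` with `Q` negative definite on the kernel of `Z` in `Γ_ℝ`, and classes `W^σ_{β,S}`. -/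
structure StringStability (bd : Γ →+ H1 X) (Q : QuadraticForm ℝ (ℝ ⊗[ℤ] Γ)) where
  /-- The central charge. -/
  Z : Γ →+ ℂ
  neg : ∀ x : ℝ ⊗[ℤ] Γ, x ≠ 0 → LinearMap.liftBaseChange ℝ Z.toIntLinearMap x = 0 → Q x < 0
  /-- The classes `W^σ_{β,S}`. -/
  W : ∀ S : Set ℂ, IsSector S → ∀ (β : Γ) (_σ : SpinStructure X), MDH bd S (charges Q Z S) β
  twist : ∀ S (hS : IsSector S) β σ (ε : Multiplicative (H1 X) →* ℤˣ),
    W S hS β (σ.twist ε) =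
      (((ε (Multiplicative.ofAdd (bd β)) : ℤˣ) : ℤ) : ℚ) • W S hS β σ
  /-- `𝓕_{β₁,…,βᵣ}(W_β) = (W_{β₁} ∪ ⋯ ∪ W_{βᵣ}) / |Aut{β₁,…,βᵣ}|`. -/
  factor : ∀ S (hS : IsSector S) σ (r : ℕ) (b : Fin (r + 1) → Γ) (β : Γ), (∑ i, b i) = β →
    factorMap bd S (charges Q Z S) β b (W S hS β σ) =
      ((autCard b : ℚ)⁻¹) • unionClass (cupData S (charges Q Z S) b) fun i => W S hS (b i) σ
  /-- `W_{β,S} = ∑_{β₁+β₂=β} W_{β₁,S₁} ∪ W_{β₂,S₂}` if `S = S₁ ⊔ S₂` in clockwise order. -/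
  factor_sector : ∀ S (hS : IsSector S) (S' : Fin 2 → Set ℂ) (hS' : ∀ i, IsSector (S' i)) σ (β : Γ)
    (hu : S = S' 0 ∪ S' 1) (hd : Disjoint (S' 0) (S' 1)),
    (∀ u ∈ S' 0, ∀ w ∈ S' 1, Before u w) →
    Set.Finite (Function.support fun b : {b : Fin 2 → Γ // b 0 + b 1 = β} =>
      unionClass (sectorData Q Z hu hd b.1 b.2) fun i => W (S' i) (hS' i) (b.1 i) σ) ∧
    W S hS β σ = ∑ᶠ b : {b : Fin 2 → Γ // b 0 + b 1 = β},
      unionClass (sectorData Q Z hu hd b.1 b.2) fun i => W (S' i) (hS' i) (b.1 i) σ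

variable {bd : Γ →+ H1 X} {Q : QuadraticForm ℝ (ℝ ⊗[ℤ] Γ)}

/-- The central charge `Z` is on an `(S, β)`-wall of second type: `β = β₁ + β₂` with
`β₁, β₂ ∈ Γ(S, Z, Q)`, `β₁ ≠ 0` and `Z β₁ ∈ ∂S`. So that the condition makes sense for each
boundary ray, whether it belongs to `S` or not, `S` is first completed by its boundary rays; for
closed sectors this changes nothing. -/
def OnSecondWall (Q : QuadraticForm ℝ (ℝ ⊗[ℤ] Γ)) (S : Set ℂ) (β : Γ) (Z : Γ →+ ℂ) : Prop :=
  ∃ β₁ β₂ : Γ, β₁ ∈ charges Q Z (closure S \ {0}) ∧ (β₂ ∈ charges Q Z (closure S \ {0}) ∨ β₂ = 0) ∧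
    Z β₁ ∈ frontier S ∧ β = β₁ + β₂

/-- The element `A^σ_S` of the product over `β` of the graded pieces of the enveloping algebra. -/
def StringStability.A (𝒲 : StringStability bd Q) (σ : SpinStructure X) (S : Set ℂ)
    (hS : IsSector S) : ∀ β : Γ, gradedPiece (plainCoeff bd) (charges Q 𝒲.Z S) β :=
  fun β => toEnvelope bd S (charges Q 𝒲.Z S) β (𝒲.W S hS β σ)

/-- The element `Â_S`, the image of `A^σ_S` under `e_β ↦ σ(∂β) ê_β`. -/
def StringStability.AHat (𝒲 : StringStability bd Q) (σ : SpinStructure X) (S : Set ℂ)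
    (hS : IsSector S) : ∀ β : Γ, gradedPiece (twistedCoeff bd) (charges Q 𝒲.Z S) β :=
  fun β => ⟨sigmaEnv bd σ _ (𝒲.A σ S hS β), sigmaEnv_mem bd σ _ β _ (𝒲.A σ S hS β).2⟩

/-- A variation of string stability structures: a family parametrized by `t ∈ [0, 1]` such that
`W^σ_{β,S,t}` does not depend on `t` whenever `Z_t` is not on an `(S, β)`-wall of second type for
any `t`. Classes for different central charges are compared in the multi-disk homology with all
charges allowed. -/
structure Variation (bd : Γ →+ H1 X) (Q : QuadraticForm ℝ (ℝ ⊗[ℤ] Γ)) where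
  /-- The members of the family. -/
  at_ : unitInterval → StringStability bd Q
  constant : ∀ S (hS : IsSector S) (β : Γ), (∀ t, ¬ OnSecondWall Q S β (at_ t).Z) →
    ∀ (σ : SpinStructure X) (s t : unitInterval),
      inclusion (le_top (a := charges Q (at_ s).Z S)) ((at_ s).W S hS β σ) =
        inclusion (le_top (a := charges Q (at_ t).Z S)) ((at_ t).W S hS β σ)

/-- The `β`-component of `Â_S`, in the enveloping algebra of the Lie algebra of all charges. -/
def StringStability.component (𝒲 : StringStability bd Q) (σ : SpinStructure X) (S : Set ℂ)
    (hS : IsSector S) (β : Γ) : Envelope (twistedCoeff bd) (⊤ : AddSubsemigroup Γ) :=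
  envIncl (twistedCoeff bd) (le_top (a := charges Q 𝒲.Z S)) (𝒲.AHat σ S hS β)

end Stability


end MultiDisk

end

open scoped Manifold ContDiff TensorProduct

noncomputable section

namespace MultiDisk

attribute [local instance 100] LieRing.ofAssociativeRing

/-! ### Naturality in the set of charges -/

section Natural

variable {X : Type} [TopologicalSpace X] [ChartedSpace Plane X]
variable {Γ : Type} [AddCommGroup Γ]

/-! The `β`-component of `Â_S` is the image of the class `W^σ_{β,S}` under a chain of linear maps:
from multi-disk homology to the graded piece of the enveloping algebra of `𝔤_P`, then along `e_β ↦
σ(∂β) ê_β`, then along the inclusion into the enveloping algebra with all charges. Here `P = charges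
Q Z S` depends on the central charge, so at different times the classes and the intermediate
algebras are different objects and cannot be compared directly.

Naturality removes this dependence. Both the map to the enveloping algebra (`toEnvelope_natural`)
and the sign map (`sigmaEnv_envIncl`) commute with enlarging `P`, so the enlargement to all charges
can be carried out first, already in multi-disk homology. The result, `component_eq`, writes the
component as the value, at the image of `W^σ_{β,S}` in `MDH₀(β; S, Γ)`, of a linear map that depends
on `σ`, `S` and `β` but not on `Z`. Away from the walls of second type this image is constant in a
variation by definition, and hence so is the component.

For the spin structure, fix the time. Two quadratic refinements of the same pairing differ by a
character `ε` of `H₁`, because the signs `(-1)^⟨a,b⟩` cancel in their quotient (`exists_twist`).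
Replacing `σ` by `εσ` then has two effects. The class `W^σ_{β,S}` is multiplied by `ε(∂β)`, by an
axiom of string stability structures. The sign map is also multiplied by `ε(∂β)` in degree `β`: on a
product of generators each factor contributes the value of `ε` at its own boundary, and these values
multiply to the value at the total boundary (`sigmaEnv_twist`). The two factors cancel since `ε(∂β)²
= 1`.

Both comparisons of algebra maps rest on one principle, `eq_smul_of_mem_gradedPiece`: a discrepancy
on generators that is a character of the charge is, on a whole graded piece, a single scalar. -/

/-- The map from multi-disk homology to the enveloping algebra is natural in the charges. -/
theorem toEnvelope_natural (bd : Γ →+ H1 X) (S : Set ℂ) {P P' : AddSubsemigroup Γ} (h : P ≤ P')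
    (β : Γ) (W : MDH bd S P β) :
    envIncl (plainCoeff bd) h (toEnvelope bd S P β W) =
      (toEnvelope bd S P' β (inclusion h W) : Envelope (plainCoeff bd) P') := by
  unfold toEnvelope
  -- The condition asks for a family indexed by all `P` and `β` at once and does not involve `P`, so
  -- both sides unfold to members of the same chosen family and its naturality applies. In the other
  -- case both maps are the default value zero.
  split_ifs with hΦ
  · exact hΦ.choose_spec.natural P P' h β W
  · simp

theorem envIncl_envGen (κ : BracketCoeff Γ) {P P' : AddSubsemigroup Γ} (h : P ≤ P') (β : P) :
    envIncl κ h (envGen κ P β) = envGen κ P' ⟨β, h β.2⟩ := by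
  unfold envIncl envGen
  rw [UniversalEnvelopingAlgebra.lift_ι_apply]
  rfl

/-- If two algebra maps out of the enveloping algebra differ on the generators by a character of
the charges, then they differ by the value of this character at `β` in degree `β`. -/
theorem eq_smul_of_mem_gradedPiece {κ : BracketCoeff Γ} {P : AddSubsemigroup Γ} {A : Type}
    [Ring A] [Algebra ℚ A] (f g : Envelope κ P →ₐ[ℚ] A) (χ : Multiplicative Γ →* ℚ)
    (hfg : ∀ β : P, f (envGen κ P β) = χ (Multiplicative.ofAdd β.1) • g (envGen κ P β))
    {β : Γ} {x : Envelope κ P} (hx : x ∈ gradedPiece κ P β) :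
    f x = χ (Multiplicative.ofAdd β) • g x := by
  induction hx using Submodule.span_induction with
  | zero => simp
  | add x y _ _ hx hy => rw [map_add, map_add, hx, hy, smul_add]
  | smul r x _ hx => rw [map_smul, map_smul, hx, smul_comm]
  | mem x h =>
    -- The degree becomes the sum of the list `l`, so that the induction on `l` shortens the product
    -- and its total charge together. No question of well-definedness arises from different ways to
    -- write an element as a product, because `f` and `g` are given as maps on the whole algebra.
    obtain ⟨l, rfl, rfl⟩ := h
    induction l with
    -- The empty product is the unit, in degree `0`, where the character has value `1`.
    | nil => simp
    | cons a l ih =>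
      -- Scalars are central, so the factor of the head and the factor of the tail can be collected
      -- in front; the multiplicativity of `χ` turns their product into the value at the total
      -- charge.
      rw [List.map_cons, List.prod_cons, map_mul, map_mul, hfg, ih, smul_mul_smul_comm,
        List.map_cons, List.sum_cons, ofAdd_add, map_mul]

/-- The map `e_β ↦ σ(∂β) ê_β` is compatible with enlarging the set of charges. -/
theorem sigmaEnv_envIncl (bd : Γ →+ H1 X) (σ : SpinStructure X) {P P' : AddSubsemigroup Γ}
    (h : P ≤ P') {β : Γ} {x : Envelope (plainCoeff bd) P}
    (hx : x ∈ gradedPiece (plainCoeff bd) P β) :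
    sigmaEnv bd σ P' (envIncl (plainCoeff bd) h x) =
      envIncl (twistedCoeff bd) h (sigmaEnv bd σ P x) := by
  -- The character is trivial here: both composites send `e_a` to `σ(∂a) ê_a`, so there is no
  -- discrepancy at all.
  have := eq_smul_of_mem_gradedPiece ((sigmaEnv bd σ P').comp (envIncl (plainCoeff bd) h))
    ((envIncl (twistedCoeff bd) h).comp (sigmaEnv bd σ P)) 1 (fun a => by
      simp only [AlgHom.comp_apply, envIncl_envGen, sigmaEnv_envGen, map_smul,
        MonoidHom.one_apply, one_smul]) hx
  simpa using this

end Natural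

/-! ### Change of the spin structure -/

section Spin

variable {X : Type} [TopologicalSpace X] [ChartedSpace Plane X]
variable {Γ : Type} [AddCommGroup Γ]

/-- The action of `H¹(X, ℤ/2)` on spin structures is transitive. -/
theorem SpinStructure.exists_twist (σ σ' : SpinStructure X) :
    ∃ ε : Multiplicative (H1 X) →* ℤˣ, σ' = σ.twist ε := by
  -- In `{±1}` each element is its own inverse, so this product is the quotient of the two
  -- refinements.
  refine ⟨MonoidHom.mk' (fun a => σ.toFun a.toAdd * σ'.toFun a.toAdd) fun a b => ?_, ?_⟩
  · have h := σ.map_mul' a.toAdd b.toAdd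
    have h' := σ'.map_mul' a.toAdd b.toAdd
    -- Each refinement contributes the same sign `(-1)^⟨a,b⟩`, and the square of this sign is `1`;
    -- what remains is additive in the argument.
    rw [mul_mul_mul_comm, h, h', mul_mul_mul_comm, Int.units_mul_self, one_mul, toAdd_mul]
  · cases σ'
    simp only [SpinStructure.twist, SpinStructure.mk.injEq]
    funext a
    simp only [MonoidHom.mk'_apply, toAdd_ofAdd]
    rw [mul_right_comm, Int.units_mul_self, one_mul]

/-- Twisting the spin structure multiplies `e_β ↦ σ(∂β) ê_β` by `ε(∂β)` in degree `β`. -/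
theorem sigmaEnv_twist (bd : Γ →+ H1 X) (σ : SpinStructure X)
    (ε : Multiplicative (H1 X) →* ℤˣ) {P : AddSubsemigroup Γ} {β : Γ}
    {x : Envelope (plainCoeff bd) P} (hx : x ∈ gradedPiece (plainCoeff bd) P β) :
    sigmaEnv bd (σ.twist ε) P x =
      (((ε (Multiplicative.ofAdd (bd β)) : ℤˣ) : ℤ) : ℚ) • sigmaEnv bd σ P x := by
  refine eq_smul_of_mem_gradedPiece (sigmaEnv bd (σ.twist ε) P) (sigmaEnv bd σ P)
    -- This is the character `ε ∘ ∂` of the charges, with its values `±1` regarded as rational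
    -- numbers.
    (((Int.castRingHom ℚ : ℤ →* ℚ).comp (Units.coeHom ℤ)).comp
      (ε.comp (AddMonoidHom.toMultiplicative bd))) (fun a => ?_) hx
  rw [sigmaEnv_envGen, sigmaEnv_envGen, smul_smul]
  congr 1
  simp [SpinStructure.twist]

end Spin

/-! ### The `β`-component and its two invariances -/

section Component

variable {X : Type} [TopologicalSpace X] [ChartedSpace Plane X]
variable {Γ : Type} [AddCommGroup Γ]
variable {bd : Γ →+ H1 X} {Q : QuadraticForm ℝ (ℝ ⊗[ℤ] Γ)}

/-- The `β`-component of `Â_S` is determined by the class of `W^σ_{β,S}` in the multi-disk homology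
with all charges allowed. -/
theorem StringStability.component_eq (𝒲 : StringStability bd Q) (σ : SpinStructure X) (S : Set ℂ)
    (hS : IsSector S) (β : Γ) :
    𝒲.component σ S hS β = sigmaEnv bd σ ⊤
      (toEnvelope bd S ⊤ β (inclusion (le_top (a := charges Q 𝒲.Z S)) (𝒲.W S hS β σ))) := by
  -- The inclusion of charges is moved outwards, first past the map to the enveloping algebra and
  -- then past the sign map. The second move needs a homogeneous element, which holds because the
  -- values of `toEnvelope` lie in the graded piece of degree `β`. Afterwards both sides agree by
  -- unfolding the definition of `Â_S`.
  rw [← toEnvelope_natural, sigmaEnv_envIncl bd σ _ (Subtype.property _)]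
  rfl

/-- The `β`-component of `Â_S` does not depend on the spin structure. -/
theorem StringStability.component_spin (𝒲 : StringStability bd Q) (σ σ' : SpinStructure X)
    (S : Set ℂ) (hS : IsSector S) (β : Γ) :
    𝒲.component σ S hS β = 𝒲.component σ' S hS β := by
  obtain ⟨ε, rfl⟩ := σ.exists_twist σ'
  have hε : (((ε (Multiplicative.ofAdd (bd β)) : ℤˣ) : ℤ) : ℚ) *
      (((ε (Multiplicative.ofAdd (bd β)) : ℤˣ) : ℤ) : ℚ) = 1 := by
    rw [← Int.cast_mul, ← Units.val_mul, Int.units_mul_self]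
    simp
  -- On the twisted side one factor `ε(∂β)` comes from the sign map and another from the class. The
  -- latter passes by linearity through the inclusion of charges, the map to the enveloping algebra
  -- and the sign map, until it meets the former.
  rw [𝒲.component_eq, 𝒲.component_eq, sigmaEnv_twist bd σ ε (Subtype.property _), 𝒲.twist,
    map_smul, map_smul, Submodule.coe_smul, map_smul, smul_smul, hε, one_smul]

/-- The `β`-component of `Â_S` is constant in a variation away from the walls of second type. -/
theorem Variation.component_const (𝒱 : Variation bd Q) (σ : SpinStructure X) {S : Set ℂ}
    (hS : IsSector S) {β : Γ} (hwall : ∀ t, ¬ OnSecondWall Q S β (𝒱.at_ t).Z)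
    (s t : unitInterval) :
    (𝒱.at_ s).component σ S hS β = (𝒱.at_ t).component σ S hS β := by
  -- Once both sides are expressed through the multi-disk homology with all charges, time enters
  -- only through the class there, which is what the definition of a variation keeps fixed.
  rw [StringStability.component_eq, StringStability.component_eq, 𝒱.constant S hS β hwall σ s t]

end Component

end MultiDisk

end

theorem mainTheorem6 {X : Type} [TopologicalSpace X] [ChartedSpace MultiDisk.Plane X]
    [MultiDisk.OrientedSurface X] {Γ : Type} [AddCommGroup Γ] [Module.Free ℤ Γ]
    (bd : Γ →+ MultiDisk.H1 X) (Q : QuadraticForm ℝ (ℝ ⊗[ℤ] Γ))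
    (𝒱 : MultiDisk.Variation bd Q) (S : Set ℂ) (hS : MultiDisk.IsSector S) (β : Γ)
    (hwall : ∀ t : unitInterval, ¬ MultiDisk.OnSecondWall Q S β (𝒱.at_ t).Z)
    (σ σ' : MultiDisk.SpinStructure X) (s t : unitInterval) :
    (𝒱.at_ s).component σ S hS β = (𝒱.at_ t).component σ' S hS β :=
  -- The spin structure is changed first, at the single time `s`; then time is moved with `σ'`
  -- fixed, and only this second move calls on the absence of walls.
  ((𝒱.at_ s).component_spin σ σ' S hS β).trans (𝒱.component_const σ' hS hwall s t)
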